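/- Let $n\ge 2$ and $p\ge 1$, let $\mathbb M^n$ and $\mathbb M_*^n$ be smooth Riemannian manifolds of dimension $n$ (Hausdorff, second countable, not necessarily connected) with geodesic distances $d,d_*$ and Riemannian volumes $v,v_*$, let $D\subset\mathbb M^n$ be a domain, and let $f:D\to\mathbb M_*^n$ be continuous. A curve is a continuous map $\gamma$ of a nondegenerate interval $I\subset\mathbb R$ (open, half-open or closed) into a manifold; it is locally rectifiable if all its closed subcurves have finite length. In that case, for a fixed $t_0\in I$, $l_\gamma(t)$ denotes the signed length of $\gamma$ between $t_0$ and $t$, $\Delta_\gamma=l_\gamma(I)$, and $\int_\gamma\rho\,ds$ is the integral of $\rho$ with respect to arc length. For a family $\Gamma$ of curves in a manifold, $\rho\in\operatorname{adm}\Gamma$ means that $\rho$ is a Borel function on the manifold with values in $[0,\infty]$ and $\int_\gamma\rho\,ds\ge 1$ for every locally rectifiable $\gamma\in\Gamma$. Put $$M_p(\Gamma)=\inf_{\rho\in\operatorname{adm}\Gamma}\int_{\mathbb M^n}\rho^p\,dv$$ for families of curves in $\mathbb M^n$ (with $M_p(\Gamma)=\infty$ if $\operatorname{adm}\Gamma=\varnothing$),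 and $f(\Gamma)=\{f\circ\gamma:\gamma\in\Gamma\}$. A property holds for $p$-almost every curve if the family of curves for which it fails has $p$-modulus zero. Suppose that: * $f$ is differentiable at almost every point of $D$; * $f$ has Luzin's properties $N$ and $N^{-1}$: for $S\subset D$, $v(S)=0$ implies $v_*(f(S))=0$, and $v_*(f(S))=0$ implies $v(S)=0$; * $f\in ACP_p$: for $p$-almost every locally rectifiable curve $\gamma$ in $D$, the curve $f\circ\gamma$ is locally rectifiable and the function $L_{\gamma,f}$ on $\Delta_\gamma$ determined by $L_{\gamma,f}(l_\gamma(t))=l_{f\circ\gamma}(t)$, $t\in I$, is absolutely continuous on every closed interval contained in $\Delta_\gamma$. Put $$L(x,f)=\limsup_{y\to x}\frac{d_*(f(x),f(y))}{d(x,y)},\qquad J(x,f)=\limsup_{r\to0}\frac{v_*(f(B(x,r)))}{v(B(x,r))},$$ and let $K_{O,p}(x,f)=L^p(x,f)/J(x,f)$ if $J(x,f)\ne0$, $K_{O,p}(x,f)=1$ if $J(x,f)=0$ and $f$ is differentiable at $x$ with $f'(x)=0$, and $K_{O,p}(x,f)=\infty$ otherwise. Let $q:\mathbb M_*^n\to[0,\infty]$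 be a Borel function such that $K_{O,p}(x,f)\le q(f(x))$ for almost every $x\in D$. Then for every Borel set $A\subset D$, every family $\Gamma$ of curves lying in $A$ and every $\rho'\in\operatorname{adm}f(\Gamma)$, $$M_p(\Gamma)\le\int_{\mathbb M_*^n}\rho'^{\,p}(y)\,N(y,f,A)\,q(y)\,dv_*(y),$$ where $N(y,f,A)$ is the number (possibly $\infty$) of points $x\in A$ with $f(x)=y$, and $0\cdot\infty=0$. -/

import Mathlib

open scoped Manifold ContDiff ENNReal Topology
open MeasureTheory Set Filter Bundle

/-! ### Riemannian volume -/

section Volume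

variable {n : ℕ} (M : Type*) [EMetricSpace M] [ChartedSpace (EuclideanSpace ℝ (Fin n)) M]
  [RiemannianBundle (fun x : M => TangentSpace (𝓡 n) x)]

/-- The matrix `g_{ij}` of the Riemannian metric in the chart around `x`, at the point of
coordinates `u`. -/
noncomputable def metricMatrix (x : M) (u : EuclideanSpace ℝ (Fin n)) :
    Matrix (Fin n) (Fin n) ℝ :=
  Matrix.of fun i j =>
    inner ℝ
      (mfderiv (𝓡 n) (𝓡 n) (extChartAt (𝓡 n) x).symm u (EuclideanSpace.single i (1 : ℝ)))
      (mfderiv (𝓡 n) (𝓡 n) (extChartAt (𝓡 n) x).symm u (EuclideanSpace.single j (1 : ℝ)))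

variable [MeasurableSpace M]

/-- The measure `√(det g_{ij}) dx¹ ⋯ dxⁿ` on the domain of the chart around `x`, regarded as a
measure on `M`. -/
noncomputable def chartVolume (x : M) : Measure M :=
  ((volume.restrict (extChartAt (𝓡 n) x).target).withDensity
    fun u => ENNReal.ofReal (Real.sqrt (metricMatrix M x u).det)).map (extChartAt (𝓡 n) x).symm

/-- The Riemannian volume `v`. The measures `√(det g_{ij}) dx¹ ⋯ dxⁿ` of any two charts agree on
the common domain; `v` is the measure on `M` which they form together, that is, the least measure
which dominates all of them. -/
noncomputable def riemannianVolume : Measure M := ⨆ x : M, chartVolume (n := n) M x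

end Volume

/-! ### Curves, length, line integrals, modulus -/

/-- A curve: a continuous map of a nondegenerate interval `I` (open, half-open or closed).
Only the values of `toFun` on `I` matter. -/
structure IntervalCurve (X : Type*) [TopologicalSpace X] where
  I : Set ℝ
  toFun : ℝ → X
  ordConnected : I.OrdConnected
  nontrivial : I.Nontrivial
  continuousOn : ContinuousOn toFun I

namespace IntervalCurve

variable {X Y : Type*} [EMetricSpace X] [EMetricSpace Y]

/-- The curve lies in the set `A`. -/
def LiesIn (γ : IntervalCurve X) (A : Set X) : Prop := ∀ t ∈ γ.I, γ.toFun t ∈ A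

/-- A base parameter `t₀ ∈ I`. -/
noncomputable def base (γ : IntervalCurve X) : ℝ := γ.nontrivial.nonempty.some

/-- Every closed subcurve has finite length. -/
def LocallyRectifiable (γ : IntervalCurve X) : Prop := LocallyBoundedVariationOn γ.toFun γ.I

/-- The length function `l_γ`: the signed length of `γ` between `t₀` and `t`. -/
noncomputable def length (γ : IntervalCurve X) : ℝ → ℝ :=
  variationOnFromTo γ.toFun γ.I γ.base

/-- The interval `Δ_γ = l_γ(I)` of values of the arc length parameter. -/
def lengthInterval (γ : IntervalCurve X) : Set ℝ := γ.length '' γ.I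

/-- The line integral of `ρ` along a locally rectifiable curve with respect to arc length. -/
noncomputable def lineIntegral (γ : IntervalCurve X) (ρ : X → ℝ≥0∞) : ℝ≥0∞ :=
  ∫⁻ s in γ.lengthInterval, ρ (naturalParameterization γ.toFun γ.I γ.base s)

/-- The function `L_{γ,f}` on `Δ_γ`, characterized by `L_{γ,f} (l_γ t) = l_{f ∘ γ} t`. -/
noncomputable def lengthTransfer (γ : IntervalCurve X) (f : X → Y) : ℝ → ℝ := fun s =>
  variationOnFromTo (f ∘ γ.toFun) γ.I γ.base (Function.invFunOn γ.length γ.I s)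

/-- The family `f(Γ) = {f ∘ γ | γ ∈ Γ}`. -/
def imageFamily (f : X → Y) (Γ : Set (IntervalCurve X)) : Set (IntervalCurve Y) :=
  {β | ∃ γ ∈ Γ, β.I = γ.I ∧ ∀ t ∈ γ.I, β.toFun t = f (γ.toFun t)}

/-- `ρ ∈ adm Γ`: a Borel function `ρ : X → [0, ∞]` whose line integral along every locally
rectifiable curve of the family is at least `1`. -/
def Admissible [MeasurableSpace X] (Γ : Set (IntervalCurve X)) (ρ : X → ℝ≥0∞) : Prop :=
  Measurable ρ ∧ ∀ γ ∈ Γ, γ.LocallyRectifiable → 1 ≤ γ.lineIntegral ρ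

/-- The `p`-modulus of a family of curves with respect to the measure `v`
(it is `∞` if there is no admissible function). -/
noncomputable def modulus [MeasurableSpace X] (v : Measure X) (p : ℝ)
    (Γ : Set (IntervalCurve X)) : ℝ≥0∞ :=
  ⨅ (ρ : X → ℝ≥0∞) (_ : Admissible Γ ρ), ∫⁻ x, ρ x ^ p ∂v

/-- `f ∈ ACP_p` in `D`: for `p`-almost every curve `γ` in `D` the curve `f ∘ γ` is locally
rectifiable and `L_{γ,f}` is absolutely continuous on every closed interval in `Δ_γ`. (As usual,
`γ` itself is understood to be locally rectifiable; the other curves form a family of modulus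
zero.) -/
def ACP [MeasurableSpace X] (v : Measure X) (p : ℝ) (f : X → Y) (D : Set X) : Prop :=
  modulus v p {γ : IntervalCurve X | γ.LiesIn D ∧
    ¬ (γ.LocallyRectifiable ∧ LocallyBoundedVariationOn (f ∘ γ.toFun) γ.I ∧
      ∀ a b : ℝ, a ≤ b → Icc a b ⊆ γ.lengthInterval →
        AbsolutelyContinuousOnInterval (γ.lengthTransfer f) a b)} = 0

end IntervalCurve

/-! ### Luzin properties, multiplicity, dilatation -/

/-- Luzin's property `N` on `D`. -/
def LuzinN {X Y : Type*} [MeasurableSpace X] [MeasurableSpace Y] (v : Measure X) (v' : Measure Y)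
    (f : X → Y) (D : Set X) : Prop :=
  ∀ S ⊆ D, v S = 0 → v' (f '' S) = 0

/-- Luzin's property `N⁻¹` on `D`. -/
def LuzinNInv {X Y : Type*} [MeasurableSpace X] [MeasurableSpace Y] (v : Measure X)
    (v' : Measure Y) (f : X → Y) (D : Set X) : Prop :=
  ∀ S ⊆ D, v' (f '' S) = 0 → v S = 0

/-- The multiplicity function `N(y, f, A)`: the number of preimages of `y` in `A`. -/
noncomputable def preimageCount {X Y : Type*} (f : X → Y) (A : Set X) (y : Y) : ℝ≥0∞ :=
  (({x ∈ A | f x = y}.encard : ℕ∞) : ℝ≥0∞)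

/-- `L(x, f) = limsup_{y → x} d'(f x, f y) / d(x, y)`. -/
noncomputable def maxStretch {X Y : Type*} [EMetricSpace X] [EMetricSpace Y] (f : X → Y) (x : X) :
    ℝ≥0∞ :=
  limsup (fun y => edist (f x) (f y) / edist x y) (𝓝[≠] x)

/-- `J(x, f) = limsup_{r → 0} v'(f(B(x, r))) / v(B(x, r))`. -/
noncomputable def volumeJacobian {X Y : Type*} [EMetricSpace X] [MeasurableSpace X]
    [MeasurableSpace Y] (v : Measure X) (v' : Measure Y) (f : X → Y) (x : X) : ℝ≥0∞ :=
  limsup (fun r : ℝ≥0∞ => v' (f '' Metric.eball x r) / v (Metric.eball x r)) (𝓝[>] 0)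

open Classical in
/-- The outer dilatation `K_{O,p}(x, f)` of order `p`. -/
noncomputable def outerDilatation (n : ℕ) {M M' : Type*}
    [EMetricSpace M] [ChartedSpace (EuclideanSpace ℝ (Fin n)) M]
    [RiemannianBundle (fun x : M => TangentSpace (𝓡 n) x)] [MeasurableSpace M]
    [EMetricSpace M'] [ChartedSpace (EuclideanSpace ℝ (Fin n)) M']
    [RiemannianBundle (fun x : M' => TangentSpace (𝓡 n) x)] [MeasurableSpace M']
    (p : ℝ) (f : M → M') (x : M) : ℝ≥0∞ :=
  if volumeJacobian (riemannianVolume (n := n) M) (riemannianVolume (n := n) M') f x ≠ 0 then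
    maxStretch f x ^ p /
      volumeJacobian (riemannianVolume (n := n) M) (riemannianVolume (n := n) M') f x
  else if MDifferentiableAt (𝓡 n) (𝓡 n) f x ∧ mfderiv (𝓡 n) (𝓡 n) f x = 0 then 1
  else ∞

/-! ### Variation of continuous curves. -/

section Variation

variable {X : Type*} [PseudoEMetricSpace X]

/-! The density `ρ'(f) · L(·, f)` on `A` is the natural pullback of `ρ'`. Parameterize a curve of
`Γ` by arc length as `c`. Outside an exceptional family of `p`-modulus zero, `Λ = L_{γ,f}` is
absolutely continuous on compact intervals; it measures length along `f ∘ c` and satisfies `Λ' ≤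
L(c, f)` almost everywhere (`ae_ofReal_deriv_le_maxStretch`). Substituting `s = Λ r` gives `∫_{f∘γ}
ρ' ds ≤ ∫_γ ρ'(f) L(·, f) ds` (`IntervalCurve.lineIntegral_map_le`). The exceptional family costs
arbitrarily little energy, so `M_p(Γ) ≤ ∫_A ρ'(f)^p L^p dv`
(`IntervalCurve.modulus_le_setLIntegral_maxStretch`).

This integral is then pushed forward by `f` in charts. The image of the set where the differential
is singular is null, so property `N⁻¹` makes the Jacobian determinant nonzero almost everywhere
(`LuzinNInv.ae_det_fderiv_ne_zero`). Where it is nonzero, small balls are nearly ellipsoids, and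
comparing their volumes bounds `J(x, f)` by the Jacobian taken with respect to the Riemannian
densities (`volumeJacobian_mul_chartDensity_le`). Hence `L^p ≤ K J ≤ q(f) · |Jacobian|` if `J ≠ 0`;
if `J = 0`, then `f' ≠ 0` forces `K = ∞`, so `q(f) = ∞` and the bound is trivial.

Finally, the area formula on countably many disjoint pieces where `f` is injective produces `∫ ρ'^p
q Σ 1_{f(piece)} dv'`. The sum of indicators is measurable and at most `N(y, f, A)`, so
measurability of `N(·, f, A)` itself is never needed. -/

theorem LocallyBoundedVariationOn.continuousOn_variationOnFromTo {g : ℝ → X} {s : Set ℝ}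
    (hv : LocallyBoundedVariationOn g s) (hg : ContinuousOn g s) {a : ℝ} (ha : a ∈ s) :
    ContinuousOn (variationOnFromTo g s a) s := by
  intro b hb
  have hl : Tendsto (fun y => eVariationOn g (s ∩ Icc y b)) (𝓝[s ∩ Iio b] b) (𝓝 0) := by
    simpa using hv.tendsto_eVariationOn_Icc_left
      ((hg b hb).mono_left (nhdsWithin_mono _ inter_subset_left)) hb
  have hr : Tendsto (fun y => eVariationOn g (s ∩ Icc b y)) (𝓝[s ∩ Ioi b] b) (𝓝 0) := by
    simpa using hv.tendsto_eVariationOn_Icc_right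
      ((hg b hb).mono_left (nhdsWithin_mono _ inter_subset_left)) hb
  have key : Tendsto (variationOnFromTo g s b) (𝓝[s] b) (𝓝 0) := by
    have hs : s = (s ∩ Iio b) ∪ ({b} ∪ (s ∩ Ioi b)) := by
      ext t
      rcases lt_trichotomy t b with h | rfl | h
      · simp [h, h.ne, h.le]
      · simp [hb]
      · simp [h, h.ne', h.le]
    rw [hs, nhdsWithin_union, nhdsWithin_union, ← hs]
    refine Tendsto.sup ?_ (Tendsto.sup ?_ ?_)
    · have := ((ENNReal.tendsto_toReal ENNReal.zero_ne_top).comp hl).neg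
      simp only [ENNReal.toReal_zero, neg_zero] at this
      refine this.congr' ?_
      filter_upwards [self_mem_nhdsWithin] with y hy
      rw [variationOnFromTo.eq_of_ge g s (le_of_lt hy.2)]
      rfl
    · rw [nhdsWithin_singleton, tendsto_pure_left]
      intro t ht
      rw [variationOnFromTo.self]
      exact mem_of_mem_nhds ht
    · have := (ENNReal.tendsto_toReal ENNReal.zero_ne_top).comp hr
      simp only [ENNReal.toReal_zero] at this
      refine this.congr' ?_
      filter_upwards [self_mem_nhdsWithin] with y hy
      rw [variationOnFromTo.eq_of_le g s (le_of_lt hy.2)]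
      rfl
  have h2 := key.const_add (variationOnFromTo g s a b)
  rw [add_zero] at h2
  refine h2.congr' ?_
  filter_upwards [self_mem_nhdsWithin] with y hy
  exact variationOnFromTo.add hv ha hb hy

theorem LocallyBoundedVariationOn.eVariationOn_eq_ofReal_sub {g : ℝ → X} {s : Set ℝ}
    (hv : LocallyBoundedVariationOn g s) {a t t' : ℝ} (ha : a ∈ s) (ht : t ∈ s) (ht' : t' ∈ s)
    (h : t ≤ t') : eVariationOn g (s ∩ Icc t t') =
      ENNReal.ofReal (variationOnFromTo g s a t' - variationOnFromTo g s a t) := by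
  rw [variationOnFromTo.sub_right hv ha ht' ht, variationOnFromTo.eq_of_le g s h,
    ENNReal.ofReal_toReal (hv t t' ht ht')]

theorem LocallyBoundedVariationOn.edist_le_ofReal_sub {g : ℝ → X} {s : Set ℝ}
    (hv : LocallyBoundedVariationOn g s) {a t t' : ℝ} (ha : a ∈ s) (ht : t ∈ s) (ht' : t' ∈ s)
    (h : t ≤ t') : edist (g t) (g t') ≤
      ENNReal.ofReal (variationOnFromTo g s a t' - variationOnFromTo g s a t) := by
  rw [← hv.eVariationOn_eq_ofReal_sub ha ht ht' h]
  exact eVariationOn.edist_le g ⟨ht, le_rfl, h⟩ ⟨ht', h, le_rfl⟩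

/-- The integral is additive over the cells of a partition, so the bound on single cells adds up. No
measurability of `m` enters, since only the domains are split. -/
theorem eVariationOn_Icc_le_of_edist_le_setLIntegral {g : ℝ → X} {a b : ℝ} {m : ℝ → ℝ≥0∞}
    (h : ∀ s ∈ Icc a b, ∀ t ∈ Icc a b, s ≤ t → edist (g s) (g t) ≤ ∫⁻ r in Ioc s t, m r) :
    eVariationOn g (Icc a b) ≤ ∫⁻ r in Ioc a b, m r := by
  refine iSup_le ?_
  rintro ⟨n, u, hu, hmem⟩
  have key : ∀ n : ℕ, ∑ i ∈ Finset.range n, edist (g (u (i + 1))) (g (u i)) ≤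
      ∫⁻ r in Ioc (u 0) (u n), m r := by
    intro n
    induction n with
    | zero => simp
    | succ k ih =>
      rw [Finset.sum_range_succ, ← Ioc_union_Ioc_eq_Ioc (hu (Nat.zero_le k)) (hu (Nat.le_succ k)),
        lintegral_union measurableSet_Ioc (by simp)]
      refine add_le_add ih ?_
      rw [edist_comm]
      exact h _ (hmem k) _ (hmem (k + 1)) (hu (Nat.le_succ k))
  exact (key n).trans (lintegral_mono_set (Ioc_subset_Ioc (hmem 0).1 (hmem n).2))

end Variation

/-! ### Maximal stretching along an absolutely continuous curve. -/

section UpperGradient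

variable {X Y : Type*} [EMetricSpace X] [EMetricSpace Y]

/-- Eventual form of the bound of difference quotients by the maximal stretching. -/
theorem eventually_edist_le_of_maxStretch_lt {f : X → Y} {x : X} {K : ℝ≥0∞}
    (h : maxStretch f x < K) : ∀ᶠ y in 𝓝 x, edist (f x) (f y) ≤ K * edist x y := by
  have h1 := Filter.eventually_lt_of_limsup_lt h
  rw [eventually_nhdsWithin_iff] at h1
  filter_upwards [h1] with y hy
  rcases eq_or_ne y x with rfl | hne
  · simp
  · have := (hy hne).le
    rcases eq_or_ne (edist x y) (⊤ : ℝ≥0∞) with ht | ht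
    · rw [ht, ENNReal.mul_top (ne_bot_of_gt h)]
      exact le_top
    · rwa [ENNReal.div_le_iff (by simpa [edist_eq_zero] using hne.symm) ht] at this

/-- Applied with `φ` the distance in the target from a fixed point of the curve. For `K > L(c r, f)`
the increments near `r` obey `|φ t - φ r| ≤ K d(c r, c t) ≤ K |t - r|`. -/
theorem ofReal_deriv_le_maxStretch {f : X → Y} {c : ℝ → X} {φ : ℝ → ℝ} {r : ℝ}
    (hc : ∀ᶠ t in 𝓝 r, edist (c r) (c t) ≤ ENNReal.ofReal |t - r|)
    (hφ : ∀ᶠ t in 𝓝 r, ENNReal.ofReal |φ t - φ r| ≤ edist (f (c r)) (f (c t)))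
    (hd : DifferentiableAt ℝ φ r) :
    ENNReal.ofReal (deriv φ r) ≤ maxStretch f (c r) := by
  refine le_of_forall_gt fun K hK => ?_
  obtain ⟨K', hK', hK'2⟩ := exists_between hK
  refine lt_of_le_of_lt ?_ hK'2
  have hK'top : K' ≠ ⊤ := ne_top_of_lt hK'2
  have hcc : Tendsto c (𝓝 r) (𝓝 (c r)) := by
    rw [EMetric.tendsto_nhds]
    intro ε hε
    have : Tendsto (fun t : ℝ => ENNReal.ofReal |t - r|) (𝓝 r) (𝓝 0) := by
      have h : Continuous fun t : ℝ => ENNReal.ofReal |t - r| := ENNReal.continuous_ofReal.comp (by fun_prop)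
      simpa using h.tendsto r
    filter_upwards [hc, this.eventually (gt_mem_nhds hε)] with t h1 h2
    rw [edist_comm]
    exact h1.trans_lt h2
  have h1 := hcc.eventually (eventually_edist_le_of_maxStretch_lt hK')
  have h2 : ∀ᶠ t in 𝓝 r, ‖φ t - φ r‖ ≤ K'.toReal * ‖t - r‖ := by
    filter_upwards [h1, hc, hφ] with t a b d
    have : ENNReal.ofReal |φ t - φ r| ≤ ENNReal.ofReal (K'.toReal * |t - r|) := by
      rw [ENNReal.ofReal_mul ENNReal.toReal_nonneg, ENNReal.ofReal_toReal hK'top]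
      exact d.trans (a.trans (by gcongr))
    exact (ENNReal.ofReal_le_ofReal_iff (by positivity)).1 this
  have h3 : ‖deriv φ r‖ ≤ K'.toReal :=
    hd.hasDerivAt.le_of_lip' ENNReal.toReal_nonneg h2
  rw [← ENNReal.ofReal_toReal hK'top]
  exact ENNReal.ofReal_le_ofReal ((le_abs_self _).trans h3)

/-- If `Λ` is the length function of the curve `G = f ∘ c`, where `c` is parameterized with speed
at most one, and `Λ` is absolutely continuous, then `Λ' ≤ L(c, f)` almost everywhere. -/
theorem ae_ofReal_deriv_le_maxStretch {f : X → Y} {c : ℝ → X} {Λ : ℝ → ℝ} {a b : ℝ} (hab : a ≤ b)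
    (hc : ∀ s ∈ Icc a b, ∀ t ∈ Icc a b, s ≤ t → edist (c s) (c t) ≤ ENNReal.ofReal (t - s))
    (hG : ∀ s ∈ Icc a b, ∀ t ∈ Icc a b, s ≤ t →
      edist (f (c s)) (f (c t)) ≤ ENNReal.ofReal (Λ t - Λ s))
    (hvar : ENNReal.ofReal (Λ b - Λ a) ≤ eVariationOn (f ∘ c) (Icc a b))
    (hmono : MonotoneOn Λ (Icc a b)) (hac : AbsolutelyContinuousOnInterval Λ a b) :
    ∀ᵐ r ∂volume.restrict (Ioc a b), ENNReal.ofReal (deriv Λ r) ≤ maxStretch f (c r) := by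
  have hderiv_nonneg : ∀ r ∈ Ioo a b, 0 ≤ deriv Λ r := by
    intro r hr
    rw [← derivWithin_of_mem_nhds (Icc_mem_nhds hr.1 hr.2)]
    exact hmono.derivWithin_nonneg
  have hIoo : ∀ a b : ℝ, ∀ᵐ r ∂volume.restrict (Ioc a b), r ∈ Ioo a b := by
    intro a b
    rw [← restrict_Ioo_eq_restrict_Ioc]
    exact ae_restrict_mem measurableSet_Ioo
  have hint : ∀ ψ : ℝ → ℝ, ∀ s t, s ≤ t → AbsolutelyContinuousOnInterval ψ s t →
      (∀ r ∈ Ioo s t, 0 ≤ deriv ψ r) →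
      ENNReal.ofReal (ψ t - ψ s) = ∫⁻ r in Ioc s t, ENNReal.ofReal (deriv ψ r) := by
    intro ψ s t hst hψ hpos
    rw [← hψ.integral_deriv_eq_sub, intervalIntegral.integral_of_le hst]
    refine ofReal_integral_eq_lintegral_ofReal hψ.intervalIntegrable_deriv.1 ?_
    filter_upwards [hIoo s t] with r hr using hpos r hr
  -- The length of `f ∘ c` is `∫ Λ'`. Showing that it is also at most `∫ min(Λ', L(c, f))` forces
  -- the minimum to equal `Λ'` almost everywhere. The minimum has finite integral, and only `Λ'` has
  -- to be measurable for this conclusion.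
  set m : ℝ → ℝ≥0∞ := fun r => min (ENNReal.ofReal (deriv Λ r)) (maxStretch f (c r)) with hm
  have hseg : ∀ s ∈ Icc a b, ∀ t ∈ Icc a b, s ≤ t →
      edist ((f ∘ c) s) ((f ∘ c) t) ≤ ∫⁻ r in Ioc s t, m r := by
    intro s hs t ht hst
    have hsub : Icc s t ⊆ Icc a b := Icc_subset_Icc hs.1 ht.2
    -- The distance from `f (c s)` replaces the metric-space-valued curve by a real function whose
    -- increments are dominated by those of `Λ`, hence absolutely continuous.
    set φ : ℝ → ℝ := fun r => (edist (f (c s)) (f (c r))).toReal with hφ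
    have hfin : ∀ r ∈ Icc a b, ∀ r' ∈ Icc a b, edist (f (c r)) (f (c r')) ≠ ⊤ := by
      intro r hr r' hr'
      rcases le_total r r' with h | h
      · exact ne_top_of_le_ne_top ENNReal.ofReal_ne_top (hG r hr r' hr' h)
      · rw [edist_comm]
        exact ne_top_of_le_ne_top ENNReal.ofReal_ne_top (hG r' hr' r hr h)
    have hφ1 : ∀ r ∈ Icc a b, ∀ r' ∈ Icc a b,
        ENNReal.ofReal |φ r' - φ r| ≤ edist (f (c r)) (f (c r')) := by
      intro r hr r' hr'
      rw [← ENNReal.ofReal_toReal (hfin r hr r' hr')]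
      refine ENNReal.ofReal_le_ofReal ?_
      rw [abs_sub_le_iff]
      have hab1 := hfin s hs r hr
      have hab2 := hfin s hs r' hr'
      have hab3 := hfin r hr r' hr'
      constructor
      · rw [sub_le_iff_le_add, ← ENNReal.toReal_add hab3 hab1]
        refine ENNReal.toReal_mono (by simp [hab1, hab3]) ?_
        rw [add_comm]
        exact edist_triangle _ _ _
      · rw [sub_le_iff_le_add, ← ENNReal.toReal_add hab3 hab2]
        refine ENNReal.toReal_mono (by simp [hab2, hab3]) ?_
        rw [add_comm, edist_comm (f (c r))]
        exact edist_triangle _ _ _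
    have hφ2 : ∀ r ∈ Icc a b, ∀ r' ∈ Icc a b, |φ r' - φ r| ≤ |Λ r' - Λ r| := by
      intro r hr r' hr'
      have h := hφ1 r hr r' hr'
      rcases le_total r r' with hrr | hrr
      · have := h.trans (hG r hr r' hr' hrr)
        rw [ENNReal.ofReal_le_ofReal_iff (sub_nonneg.2 (hmono hr hr' hrr))] at this
        exact this.trans (le_abs_self _)
      · rw [edist_comm] at h
        have := h.trans (hG r' hr' r hr hrr)
        rw [ENNReal.ofReal_le_ofReal_iff (sub_nonneg.2 (hmono hr' hr hrr))] at this
        rw [abs_sub_comm (Λ r')]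
        exact this.trans (le_abs_self _)
    have hφac : AbsolutelyContinuousOnInterval φ s t := by
      have hacs : AbsolutelyContinuousOnInterval Λ s t := hac.mono (by
        rw [uIcc_of_le hst, uIcc_of_le hab]; exact hsub)
      rw [absolutelyContinuousOnInterval_iff] at hacs ⊢
      intro ε hε
      obtain ⟨δ, hδ, H⟩ := hacs ε hε
      refine ⟨δ, hδ, fun E hE hsum => lt_of_le_of_lt (Finset.sum_le_sum fun i hi => ?_)
        (H E hE hsum)⟩
      have hmem := hE.1 i hi
      rw [uIcc_of_le hst] at hmem
      rw [dist_comm, Real.dist_eq, dist_comm, Real.dist_eq]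
      exact hφ2 _ (hsub hmem.1) _ (hsub hmem.2)
    -- `φ` need not be monotone, so the negative part of `φ'` is discarded.
    have hsplit : ENNReal.ofReal (φ t - φ s) ≤ ∫⁻ r in Ioc s t, ENNReal.ofReal (deriv φ r) := by
      rw [← hφac.integral_deriv_eq_sub, intervalIntegral.integral_of_le hst]
      rw [integral_eq_lintegral_pos_part_sub_lintegral_neg_part hφac.intervalIntegrable_deriv.1]
      refine (ENNReal.ofReal_le_ofReal (sub_le_self _ ENNReal.toReal_nonneg)).trans ?_
      exact ENNReal.ofReal_toReal_le
    have hφst : ENNReal.ofReal (φ t - φ s) = edist ((f ∘ c) s) ((f ∘ c) t) := by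
      simp [hφ, ENNReal.ofReal_toReal (hfin s hs t ht)]
    rw [← hφst]
    refine hsplit.trans (lintegral_mono_ae ?_)
    have hd1 : ∀ᵐ r ∂volume.restrict (Ioc s t), DifferentiableAt ℝ φ r := by
      rw [ae_restrict_iff' measurableSet_Ioc]
      filter_upwards [hφac.ae_differentiableAt] with r hr hmem
      exact hr (by rw [uIcc_of_le hst]; exact Ioc_subset_Icc_self hmem)
    have hd2 : ∀ᵐ r ∂volume.restrict (Ioc s t), DifferentiableAt ℝ Λ r := by
      rw [ae_restrict_iff' measurableSet_Ioc]
      filter_upwards [hac.ae_differentiableAt] with r hr hmem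
      exact hr (by rw [uIcc_of_le hab]; exact hsub (Ioc_subset_Icc_self hmem))
    filter_upwards [hd1, hd2, hIoo s t] with r h1 h2 h3
    have hrab : r ∈ Icc a b := hsub (Ioo_subset_Icc_self h3)
    have hnear : ∀ᶠ t in 𝓝 r, t ∈ Icc a b :=
      mem_of_superset (Icc_mem_nhds h3.1 h3.2) hsub
    refine le_min ?_ ?_
    · refine ENNReal.ofReal_le_ofReal ?_
      have hr' : r ∈ Ioo a b := ⟨hs.1.trans_lt h3.1, h3.2.trans_le ht.2⟩
      have hdΛ := h2.hasDerivAt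
      have hdd := (hdΛ.sub h1.hasDerivAt)
      -- Domination of increments makes `Λ - φ` monotone, whence `φ' ≤ Λ'`.
      have hmono2 : MonotoneOn (Λ - φ) (Icc a b) := by
        intro u hu v hv huv
        have := hφ2 u hu v hv
        rw [abs_of_nonneg (sub_nonneg.2 (hmono hu hv huv))] at this
        have h5 := (le_abs_self _).trans this
        simp only [Pi.sub_apply]
        linarith
      have : 0 ≤ derivWithin (Λ - φ) (Icc a b) r := hmono2.derivWithin_nonneg
      rw [derivWithin_of_mem_nhds (Icc_mem_nhds hr'.1 hr'.2), hdd.deriv] at this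
      linarith
    · refine ofReal_deriv_le_maxStretch ?_ ?_ h1
      · filter_upwards [hnear] with u hu
        rcases le_total r u with h | h
        · rw [abs_of_nonneg (sub_nonneg.2 h)]
          exact hc r hrab u hu h
        · rw [abs_sub_comm, abs_of_nonneg (sub_nonneg.2 h), edist_comm]
          exact hc u hu r hrab h
      · filter_upwards [hnear] with u hu using hφ1 r hrab u hu
  have htot : ∫⁻ r in Ioc a b, ENNReal.ofReal (deriv Λ r) ≤ ∫⁻ r in Ioc a b, m r := by
    rw [← hint Λ a b hab hac hderiv_nonneg]
    exact hvar.trans (eVariationOn_Icc_le_of_edist_le_setLIntegral hseg)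
  have hfin : ∫⁻ r in Ioc a b, m r ≠ ⊤ := by
    refine ne_top_of_le_ne_top ?_ (lintegral_mono fun r => min_le_left _ _)
    rw [← hint Λ a b hab hac hderiv_nonneg]
    exact ENNReal.ofReal_ne_top
  have hmeas : AEMeasurable (fun r => ENNReal.ofReal (deriv Λ r)) (volume.restrict (Ioc a b)) :=
    (measurable_deriv Λ).ennreal_ofReal.aemeasurable
  have heq := ae_eq_of_ae_le_of_lintegral_le (Eventually.of_forall fun r => min_le_left _ _)
    hfin hmeas htot
  filter_upwards [heq] with r hr
  rw [← hr]
  exact min_le_right _ _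

/-- Change of variables for a monotone absolutely continuous function. -/
theorem setLIntegral_Icc_eq_of_absolutelyContinuous {Λ : ℝ → ℝ} {a b : ℝ} (hab : a ≤ b)
    (hmono : MonotoneOn Λ (Icc a b)) (hac : AbsolutelyContinuousOnInterval Λ a b)
    (h : ℝ → ℝ≥0∞) :
    ∫⁻ x in Icc (Λ a) (Λ b), h x = ∫⁻ r in Ioc a b, ENNReal.ofReal (deriv Λ r) * h (Λ r) := by
  -- The change of variables for monotone functions applies where `Λ` is differentiable. Injectivity
  -- of `Λ` and measurability of `h` are not required.
  set S : Set ℝ := {r | DifferentiableAt ℝ Λ r} ∩ Ioo a b with hS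
  have hSm : MeasurableSet S := (measurableSet_of_differentiableAt ℝ Λ).inter measurableSet_Ioo
  have hSab : S ⊆ Icc a b := fun r hr => Ioo_subset_Icc_self hr.2
  have hSae : S =ᵐ[volume] Ioc a b := by
    refine EventuallyEq.trans ?_ Ioo_ae_eq_Ioc
    filter_upwards [hac.ae_differentiableAt] with r hr
    refine propext ⟨fun h => h.2, fun h => ⟨hr ?_, h⟩⟩
    rw [uIcc_of_le hab]
    exact Ioo_subset_Icc_self h
  have hcv : ∀ u : ℝ → ℝ≥0∞, ∫⁻ x in Λ '' S, u x =
      ∫⁻ r in S, ENNReal.ofReal (deriv Λ r) * u (Λ r) := fun u =>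
    lintegral_image_eq_lintegral_deriv_mul_of_monotoneOn hSm
      (fun x hx => hx.1.hasDerivAt.hasDerivWithinAt) (hmono.mono hSab) u
  have hsub : Λ '' S ⊆ Icc (Λ a) (Λ b) := by
    rintro _ ⟨r, hr, rfl⟩
    exact ⟨hmono (left_mem_Icc.2 hab) (hSab hr) (hSab hr).1,
      hmono (hSab hr) (right_mem_Icc.2 hab) (hSab hr).2⟩
  -- The points left out do not matter in the image: with integrand `1` the same formula gives
  -- `|Λ(S)| = ∫ Λ' = Λ b - Λ a`, where absolute continuity is used.
  have hvol : volume (Icc (Λ a) (Λ b)) ≤ volume (Λ '' S) := by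
    have h1 := hcv 1
    simp only [Pi.one_apply, mul_one, lintegral_one, Measure.restrict_apply_univ] at h1
    rw [h1, Real.volume_Icc, ← hac.integral_deriv_eq_sub, intervalIntegral.integral_of_le hab,
      setLIntegral_congr hSae]
    rw [ofReal_integral_eq_lintegral_ofReal hac.intervalIntegrable_deriv.1]
    rw [← restrict_Ioo_eq_restrict_Ioc]
    refine (ae_restrict_iff' measurableSet_Ioo).2 (Eventually.of_forall fun r hr => ?_)
    simp only [Pi.zero_apply]
    rw [← derivWithin_of_mem_nhds (Icc_mem_nhds hr.1 hr.2)]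
    exact hmono.derivWithin_nonneg
  have hae : (Λ '' S : Set ℝ) =ᵐ[volume] Icc (Λ a) (Λ b) :=
    ae_eq_of_subset_of_measure_ge hsub hvol (hSm.image_of_monotoneOn (hmono.mono hSab)).nullMeasurableSet
      (by simp)
  rw [← setLIntegral_congr hae, hcv, setLIntegral_congr hSae]

end UpperGradient

/-! ### Line integrals along a curve and along its image. -/

section CurveInequality

/-- An interval of the real line is a directed countable union of compact intervals. -/
theorem Set.OrdConnected.exists_countable_subset_cover {Δ : Set ℝ} (hΔ : Δ.OrdConnected) :
    ∃ T : Set ℝ, T.Countable ∧ T ⊆ Δ ∧ ∀ x ∈ Δ, (∃ p ∈ T, p ≤ x) ∧ ∃ q ∈ T, x ≤ q := by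
  -- Rational points suffice except at an endpoint belonging to `Δ`, which is added by hand.
  refine ⟨(range ((↑) : ℚ → ℝ) ∩ Δ) ∪ ({x | IsLeast Δ x} ∪ {x | IsGreatest Δ x}), ?_, ?_, ?_⟩
  · refine ((countable_range _).mono inter_subset_left).union (Countable.union ?_ ?_)
    · exact Set.Subsingleton.countable fun x hx y hy => hx.unique hy
    · exact Set.Subsingleton.countable fun x hx y hy => hx.unique hy
  · rintro x (hx | hx | hx)
    · exact hx.2
    · exact hx.1
    · exact hx.1
  · intro x hx
    constructor
    · by_cases h : IsLeast Δ x
      · exact ⟨x, Or.inr (Or.inl h), le_rfl⟩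
      · have : ∃ y ∈ Δ, y < x := by
          by_contra! H
          exact h ⟨hx, fun y hy => H y hy⟩
        obtain ⟨y, hy, hyx⟩ := this
        obtain ⟨z, hz1, hz2⟩ := exists_rat_btwn hyx
        exact ⟨z, Or.inl ⟨⟨z, rfl⟩, hΔ.out hy hx ⟨hz1.le, hz2.le⟩⟩, hz2.le⟩
    · by_cases h : IsGreatest Δ x
      · exact ⟨x, Or.inr (Or.inr h), le_rfl⟩
      · have : ∃ y ∈ Δ, x < y := by
          by_contra! H
          exact h ⟨hx, fun y hy => H y hy⟩
        obtain ⟨y, hy, hyx⟩ := this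
        obtain ⟨z, hz1, hz2⟩ := exists_rat_btwn hyx
        exact ⟨z, Or.inl ⟨⟨z, rfl⟩, hΔ.out hx hy ⟨hz1.le, hz2.le⟩⟩, hz1.le⟩

variable {X Y : Type*} [EMetricSpace X] [EMetricSpace Y]

namespace IntervalCurve

theorem base_mem (γ : IntervalCurve X) : γ.base ∈ γ.I := γ.nontrivial.nonempty.some_mem

/-- The composition of a curve lying in `D` with a map which is continuous on `D`. -/
def map (γ : IntervalCurve X) {D : Set X} (hγ : γ.LiesIn D) {f : X → Y} (hf : ContinuousOn f D) :
    IntervalCurve Y where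
  I := γ.I
  toFun := f ∘ γ.toFun
  ordConnected := γ.ordConnected
  nontrivial := γ.nontrivial
  continuousOn := hf.comp γ.continuousOn hγ

theorem ordConnected_lengthInterval (γ : IntervalCurve X) (hγ : γ.LocallyRectifiable) :
    γ.lengthInterval.OrdConnected :=
  ((isPreconnected_iff_ordConnected.2 γ.ordConnected).image _
    (hγ.continuousOn_variationOnFromTo γ.continuousOn γ.base_mem)).ordConnected

/-- In arc length parameters the left side is an integral over `Λ(Δ)`. On compact intervals the
substitution `s = Λ r` yields the factor `Λ' ≤ L(c, f)`; exhausting `Δ` by such intervals gives the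
inequality. -/
theorem lineIntegral_map_le (γ : IntervalCurve X) {D : Set X} (hγD : γ.LiesIn D) {f : X → Y}
    (hf : ContinuousOn f D) (hγ : γ.LocallyRectifiable)
    (hfγ : LocallyBoundedVariationOn (f ∘ γ.toFun) γ.I)
    (hac : ∀ a b : ℝ, a ≤ b → Icc a b ⊆ γ.lengthInterval →
      AbsolutelyContinuousOnInterval (γ.lengthTransfer f) a b) (ρ : Y → ℝ≥0∞) :
    (γ.map hγD hf).lineIntegral ρ ≤ γ.lineIntegral fun x => ρ (f x) * maxStretch f x := by
  set I := γ.I with hI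
  set t₀ := γ.base with ht₀
  have ht₀I : t₀ ∈ I := γ.base_mem
  set l : ℝ → ℝ := variationOnFromTo γ.toFun I t₀ with hl
  set m : ℝ → ℝ := variationOnFromTo (f ∘ γ.toFun) I t₀ with hm
  set σ : ℝ → ℝ := Function.invFunOn l I with hσ
  set Δ : Set ℝ := l '' I with hΔ
  set c : ℝ → X := naturalParameterization γ.toFun I t₀ with hc
  set Λ : ℝ → ℝ := fun r => m (σ r) with hΛ
  have hσI : ∀ r ∈ Δ, σ r ∈ I := fun r hr => Function.invFunOn_mem hr
  have hlσ : ∀ r ∈ Δ, l (σ r) = r := fun r hr => Function.invFunOn_eq hr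
  have hcσ : ∀ r, c r = γ.toFun (σ r) := fun r => rfl
  have hlm : MonotoneOn l I := variationOnFromTo.monotoneOn hγ ht₀I
  have hmm : MonotoneOn m I := variationOnFromTo.monotoneOn hfγ ht₀I
  have hcl : ∀ t ∈ I, c (l t) = γ.toFun t := fun t ht =>
    edist_eq_zero.1 (edist_naturalParameterization_eq_zero hγ ht₀I ht)
  -- `σ` is an arbitrary right inverse of `l`, so `Λ = m ∘ σ` must be shown independent of the
  -- choice: where `l` does not grow, `γ` is constant, hence so is `f ∘ γ`, and `m` does not grow
  -- either.
  have hlm_eq : ∀ t ∈ I, ∀ t' ∈ I, t ≤ t' → l t = l t' → m t = m t' := by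
    intro t ht t' ht' htt h
    rw [hl, variationOnFromTo.eq_left_iff hγ ht₀I ht ht',
      variationOnFromTo.eq_zero_iff_of_le hγ ht ht' htt] at h
    rw [hm, variationOnFromTo.eq_left_iff hfγ ht₀I ht ht',
      variationOnFromTo.eq_zero_iff_of_le hfγ ht ht' htt]
    intro x hx y hy
    have := edist_eq_zero.1 (h hx hy)
    simp [this]
  have hΛl : ∀ t ∈ I, Λ (l t) = m t := by
    intro t ht
    have h1 : l t ∈ Δ := ⟨t, ht, rfl⟩
    rcases le_total (σ (l t)) t with h | h
    · exact hlm_eq _ (hσI _ h1) _ ht h (hlσ _ h1)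
    · exact (hlm_eq _ ht _ (hσI _ h1) h (hlσ _ h1).symm).symm
  have hσmono : MonotoneOn σ Δ := by
    intro r hr r' hr' hrr
    rcases hrr.eq_or_lt with rfl | hlt
    · exact le_rfl
    · by_contra! H
      have := hlm (hσI _ hr') (hσI _ hr) H.le
      rw [hlσ _ hr, hlσ _ hr'] at this
      exact absurd this (not_le.2 hlt)
  have hΛmono : MonotoneOn Λ Δ := fun r hr r' hr' h =>
    hmm (hσI r hr) (hσI r' hr') (hσmono hr hr' h)
  have hΔord : Δ.OrdConnected := γ.ordConnected_lengthInterval hγ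
  have hnat : ∀ r ∈ Δ, naturalParameterization (f ∘ γ.toFun) I t₀ (Λ r) = f (c r) := fun r hr =>
    edist_eq_zero.1 (edist_naturalParameterization_eq_zero hfγ ht₀I (hσI r hr))
  have hΔ' : (γ.map hγD hf).lengthInterval = Λ '' Δ := by
    change m '' I = Λ '' (l '' I)
    rw [image_image]
    exact (image_congr fun t ht => hΛl t ht).symm
  -- The base parameter is chosen from the interval alone, so `γ` and its image share `t₀`.
  change ∫⁻ s in (γ.map hγD hf).lengthInterval,
      ρ (naturalParameterization (f ∘ γ.toFun) I t₀ s) ≤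
    ∫⁻ s in Δ, ρ (f (c s)) * maxStretch f (c s)
  rw [hΔ']
  have hseg : ∀ a ∈ Δ, ∀ b ∈ Δ, a ≤ b → ∫⁻ s in Icc (Λ a) (Λ b),
      ρ (naturalParameterization (f ∘ γ.toFun) I t₀ s) ≤
        ∫⁻ s in Δ, ρ (f (c s)) * maxStretch f (c s) := by
    intro a ha b hb hab
    have hsub : Icc a b ⊆ Δ := hΔord.out ha hb
    have hacΛ : AbsolutelyContinuousOnInterval Λ a b := hac a b hab hsub
    have hmonoΛ := hΛmono.mono hsub
    rw [setLIntegral_Icc_eq_of_absolutelyContinuous hab hmonoΛ hacΛ]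
    refine le_trans ?_ (lintegral_mono_set (Ioc_subset_Icc_self.trans hsub))
    refine lintegral_mono_ae ?_
    have hae := ae_ofReal_deriv_le_maxStretch (f := f) (c := c) hab
      (fun s hs t ht hst => by
        have := hγ.edist_le_ofReal_sub ht₀I (hσI s (hsub hs)) (hσI t (hsub ht))
          (hσmono (hsub hs) (hsub ht) hst)
        rwa [← hl, hlσ _ (hsub hs), hlσ _ (hsub ht)] at this)
      (fun s hs t ht hst => hfγ.edist_le_ofReal_sub ht₀I (hσI s (hsub hs)) (hσI t (hsub ht))
        (hσmono (hsub hs) (hsub ht) hst))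
      (by
        rw [← hfγ.eVariationOn_eq_ofReal_sub ht₀I (hσI a ha) (hσI b hb) (hσmono ha hb hab)]
        -- On this parameter interval `f ∘ γ` is `f ∘ c` composed with the monotone map `l`, and
        -- such a composition cannot increase the variation.
        have heq : EqOn (f ∘ γ.toFun) ((f ∘ c) ∘ l) (I ∩ Icc (σ a) (σ b)) := by
          intro t ht
          simp [hcl t ht.1]
        rw [eVariationOn.congr heq]
        refine eVariationOn.comp_le_of_monotoneOn _ _ (hlm.mono inter_subset_left) ?_
        intro t ht
        constructor
        · rw [← hlσ a ha]
          exact hlm (hσI a ha) ht.1 ht.2.1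
        · rw [← hlσ b hb]
          exact hlm ht.1 (hσI b hb) ht.2.2)
      hmonoΛ hacΛ
    filter_upwards [hae, ae_restrict_mem measurableSet_Ioc] with r hr hmem
    rw [hnat r (hsub (Ioc_subset_Icc_self hmem)), mul_comm]
    gcongr
  obtain ⟨T, hTc, hTΔ, hT⟩ := hΔord.exists_countable_subset_cover
  -- These compact intervals form a countable directed family, so the integral over their union is
  -- the supremum of the integrals, without measurability of the integrand.
  let ι := {z : ℝ × ℝ // z ∈ T ×ˢ T ∧ z.1 ≤ z.2}
  have : Countable ι := ((hTc.prod hTc).mono fun z hz => hz.1 : {z | z ∈ T ×ˢ T ∧ z.1 ≤ z.2}.Countable)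
  have hcover : Λ '' Δ ⊆ ⋃ z : ι, Icc (Λ z.1.1) (Λ z.1.2) := by
    rintro _ ⟨r, hr, rfl⟩
    obtain ⟨⟨p, hp, hpr⟩, q, hq, hrq⟩ := hT r hr
    exact mem_iUnion.2 ⟨⟨(p, q), ⟨hp, hq⟩, hpr.trans hrq⟩,
      hΛmono (hTΔ hp) hr hpr, hΛmono hr (hTΔ hq) hrq⟩
  refine (lintegral_mono_set hcover).trans ?_
  rw [setLIntegral_iUnion_of_directed]
  · exact iSup_le fun z => hseg _ (hTΔ z.2.1.1) _ (hTΔ z.2.1.2) z.2.2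
  · rintro ⟨⟨p, q⟩, ⟨hp, hq⟩, hpq⟩ ⟨⟨p', q'⟩, ⟨hp', hq'⟩, hpq'⟩
    have hmin : min p p' ∈ T := by rcases min_choice p p' with h | h <;> rw [h] <;> assumption
    have hmax : max q q' ∈ T := by rcases max_choice q q' with h | h <;> rw [h] <;> assumption
    refine ⟨⟨(min p p', max q q'), ⟨hmin, hmax⟩,
      (min_le_left _ _).trans (hpq.trans (le_max_left _ _))⟩, ?_, ?_⟩
    · exact Icc_subset_Icc (hΛmono (hTΔ hmin) (hTΔ hp) (min_le_left _ _))
        (hΛmono (hTΔ hq) (hTΔ hmax) (le_max_left _ _))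
    · exact Icc_subset_Icc (hΛmono (hTΔ hmin) (hTΔ hp') (min_le_right _ _))
        (hΛmono (hTΔ hq') (hTΔ hmax) (le_max_right _ _))

end IntervalCurve

end CurveInequality

/-! ### Measurability of the maximal stretching. -/

section Measurability

variable {X Y : Type*} [EMetricSpace X] [EMetricSpace Y] [MeasurableSpace X] [BorelSpace X]

omit [MeasurableSpace X] [BorelSpace X] in
-- A countable basis of punctured neighbourhoods, cut down to `D` where `f` is continuous; this
-- prepares the semicontinuity argument for measurability.
theorem maxStretch_eq_iInf_iSup {f : X → Y} {D : Set X} (hD : IsOpen D) {x : X} (hx : x ∈ D) :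
    maxStretch f x = ⨅ k : ℕ, ⨆ y ∈ {y | y ∈ D ∧ y ≠ x ∧ edist x y < ((k : ℝ≥0∞) + 1)⁻¹},
      edist (f x) (f y) / edist x y := by
  have hb : (𝓝[≠] x).HasBasis (fun _ : ℕ => True)
      (fun k => {y | y ∈ D ∧ y ≠ x ∧ edist x y < ((k : ℝ≥0∞) + 1)⁻¹}) := by
    refine ⟨fun s => ?_⟩
    rw [mem_nhdsWithin_iff_eventually, Metric.nhds_basis_eball.eventually_iff]
    constructor
    · rintro ⟨ε, hε, h⟩
      obtain ⟨k, hk⟩ := ENNReal.exists_inv_nat_lt hε.ne'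
      refine ⟨k, trivial, fun y hy => h ?_ hy.2.1⟩
      rw [Metric.mem_eball, edist_comm]
      exact hy.2.2.trans (lt_of_le_of_lt (ENNReal.inv_le_inv.2 le_self_add) hk)
    · rintro ⟨k, -, h⟩
      obtain ⟨ε, hε, h2⟩ := EMetric.isOpen_iff.1 hD x hx
      refine ⟨min ε ((k : ℝ≥0∞) + 1)⁻¹, lt_min hε (by simp), fun y hy hne => h ⟨h2 ?_, hne, ?_⟩⟩
      · exact Metric.eball_subset_eball (min_le_left _ _) hy
      · rw [edist_comm]
        exact lt_of_lt_of_le hy (min_le_right _ _)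
  rw [maxStretch, hb.limsup_eq_iInf_iSup]
  simp

theorem measurable_indicator_maxStretch {f : X → Y} {D : Set X} (hD : IsOpen D)
    (hf : ContinuousOn f D) : Measurable (D.indicator (maxStretch f)) := by
  set g : ℕ → X → ℝ≥0∞ := fun k => D.indicator fun x =>
    ⨆ y ∈ {y | y ∈ D ∧ y ≠ x ∧ edist x y < ((k : ℝ≥0∞) + 1)⁻¹}, edist (f x) (f y) / edist x y
    with hg
  have heq : D.indicator (maxStretch f) = fun x => ⨅ k, g k x := by
    ext x
    by_cases hx : x ∈ D
    · simp only [hg, indicator_of_mem hx]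
      exact maxStretch_eq_iInf_iSup hD hx
    · simp [hg, indicator_of_notMem hx]
  rw [heq]
  refine Measurable.iInf fun k => measurable_of_Ioi fun a => ?_
  refine IsOpen.measurableSet ?_
  rw [isOpen_iff_mem_nhds]
  intro x hx
  have hxD : x ∈ D := by
    by_contra h
    simp [hg, indicator_of_notMem h] at hx
  simp only [hg, mem_preimage, indicator_of_mem hxD, mem_Ioi, lt_iSup_iff] at hx
  obtain ⟨y, ⟨hyD, hyx, hy⟩, hay⟩ := hx
  -- Each supremum at a fixed scale is lower semicontinuous: the same `y` that makes the quotient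
  -- exceed `a` at `x` works for all nearby `x'`.
  have h1 : Tendsto (fun x' => edist (f x') (f y) / edist x' y) (𝓝 x)
      (𝓝 (edist (f x) (f y) / edist x y)) := by
    refine ENNReal.Tendsto.div ?_ (Or.inr ?_) ?_ (Or.inl ?_)
    · exact (hf.continuousAt (hD.mem_nhds hxD)).edist tendsto_const_nhds
    · simpa [edist_eq_zero] using hyx.symm
    · exact tendsto_id.edist tendsto_const_nhds
    · exact ne_top_of_lt hy
  have h2 : Tendsto (fun x' => edist x' y) (𝓝 x) (𝓝 (edist x y)) :=
    tendsto_id.edist tendsto_const_nhds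
  filter_upwards [h1.eventually (lt_mem_nhds hay), h2.eventually (gt_mem_nhds hy),
    hD.mem_nhds hxD, isOpen_ne.mem_nhds hyx.symm] with x' h1 h2 h3 h4
  simp only [hg, mem_preimage, indicator_of_mem h3, mem_Ioi, lt_iSup_iff]
  exact ⟨y, ⟨hyD, h4.symm, h2⟩, h1⟩

theorem ContinuousOn.measurable_indicator_comp [MeasurableSpace Y] [BorelSpace Y] {f : X → Y}
    {A : Set X} (hA : MeasurableSet A) (hf : ContinuousOn f A) {h : Y → ℝ≥0∞}
    (hh : Measurable h) : Measurable (A.indicator fun x => h (f x)) := by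
  refine measurable_of_restrict_of_restrict_compl hA ?_ ?_
  · have : A.domRestrict (A.indicator fun x => h (f x)) = h ∘ A.domRestrict f := by
      ext x
      simp [domRestrict_apply]
    rw [this]
    exact hh.comp (continuousOn_iff_continuous_domRestrict.1 hf).measurable
  · have : Aᶜ.domRestrict (A.indicator fun x => h (f x)) = fun _ => 0 := by
      ext x
      simp [domRestrict_apply, indicator_of_notMem x.2]
    rw [this]
    exact measurable_const

end Measurability

/-! ### The modulus bound by an integral over the source. -/

section Modulus

variable {X Y : Type*} [EMetricSpace X] [EMetricSpace Y] [MeasurableSpace X] [BorelSpace X]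
  [MeasurableSpace Y] [BorelSpace Y]

theorem IntervalCurve.modulus_le_setLIntegral_maxStretch {v : Measure X} {p : ℝ} (hp : 1 ≤ p)
    {f : X → Y} {D : Set X} (hD : IsOpen D) (hf : ContinuousOn f D) (hACP : ACP v p f D)
    {A : Set X} (hA : MeasurableSet A) (hAD : A ⊆ D) {Γ : Set (IntervalCurve X)}
    (hΓ : ∀ γ ∈ Γ, γ.LiesIn A) {ρ' : Y → ℝ≥0∞} (hρ' : Admissible (imageFamily f Γ) ρ') :
    modulus v p Γ ≤ ∫⁻ x in A, ρ' (f x) ^ p * maxStretch f x ^ p ∂v := by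
  have hp0 : 0 < p := by linarith
  set ρ : X → ℝ≥0∞ := A.indicator fun x => ρ' (f x) * maxStretch f x with hρ
  have hρm : Measurable ρ := by
    have h1 := (hf.mono hAD).measurable_indicator_comp hA hρ'.1
    have h2 := measurable_indicator_maxStretch hD hf
    have : ρ = fun x => (A.indicator fun x => ρ' (f x)) x * D.indicator (maxStretch f) x := by
      ext x
      by_cases hx : x ∈ A
      · simp [hρ, hx, hAD hx]
      · simp [hρ, hx]
    rw [this]
    exact h1.mul h2
  have hint : ∫⁻ x, ρ x ^ p ∂v = ∫⁻ x in A, ρ' (f x) ^ p * maxStretch f x ^ p ∂v := by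
    rw [← lintegral_indicator hA]
    refine lintegral_congr fun x => ?_
    by_cases hx : x ∈ A
    · simp [hρ, hx, ENNReal.mul_rpow_of_nonneg _ _ hp0.le]
    · simp [hρ, hx, hp0]
  rw [← hint]
  refine ENNReal.le_of_forall_pos_le_add fun ε hε _ => ?_
  have hbad : modulus v p _ < ε := lt_of_eq_of_lt hACP (by exact_mod_cast hε)
  rw [modulus, iInf_lt_iff] at hbad
  obtain ⟨ρ₀, hρ₀⟩ := hbad
  rw [iInf_lt_iff] at hρ₀
  obtain ⟨hadm, hρ₀ε⟩ := hρ₀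
  -- `ρ` serves the curves with the absolute continuity property. `ρ₀`, of energy less than `ε`,
  -- serves the exceptional ones.
  have hsup : Admissible Γ (fun x => max (ρ x) (ρ₀ x)) := by
    refine ⟨hρm.max hadm.1, fun γ hγΓ hγ => ?_⟩
    have hγD : γ.LiesIn D := fun t ht => hAD (hΓ γ hγΓ t ht)
    by_cases hgood : LocallyBoundedVariationOn (f ∘ γ.toFun) γ.I ∧
      ∀ a b : ℝ, a ≤ b → Icc a b ⊆ γ.lengthInterval →
        AbsolutelyContinuousOnInterval (γ.lengthTransfer f) a b
    · have h1 : 1 ≤ (γ.map hγD hf).lineIntegral ρ' :=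
        hρ'.2 _ ⟨γ, hγΓ, rfl, fun t _ => rfl⟩ hgood.1
      refine h1.trans ((γ.lineIntegral_map_le hγD hf hγ hgood.1 hgood.2 ρ').trans ?_)
      refine setLIntegral_mono_ae' ((γ.ordConnected_lengthInterval hγ).measurableSet) ?_
      refine Eventually.of_forall fun s hs => le_max_of_le_left ?_
      have hmem : naturalParameterization γ.toFun γ.I γ.base s ∈ A :=
        hΓ γ hγΓ _ (Function.invFunOn_mem hs)
      simp only [hρ, indicator_of_mem hmem]
      exact le_rfl
    · have h1 : 1 ≤ γ.lineIntegral ρ₀ := hadm.2 γ ⟨hγD, fun h => hgood h.2⟩ hγ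
      exact h1.trans (lintegral_mono fun s => le_max_right _ _)
  refine (iInf₂_le _ hsup).trans ?_
  calc ∫⁻ x, max (ρ x) (ρ₀ x) ^ p ∂v ≤ ∫⁻ x, (ρ x ^ p + ρ₀ x ^ p) ∂v := by
        refine lintegral_mono fun x => ?_
        rcases max_choice (ρ x) (ρ₀ x) with h | h <;> simp only [h]
        · exact le_self_add
        · exact le_add_self
    _ = ∫⁻ x, ρ x ^ p ∂v + ∫⁻ x, ρ₀ x ^ p ∂v := lintegral_add_left (hρm.pow_const p) _
    _ ≤ _ := by gcongr

end Modulus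

/-! ### Gram determinants of linear maps. -/

section Gram

variable {n : ℕ} {T : Type*} [NormedAddCommGroup T] [InnerProductSpace ℝ T]

/-- The Gram matrix of the images of the standard basis vectors under a linear map. -/
noncomputable def gramOf (W : EuclideanSpace ℝ (Fin n) →ₗ[ℝ] T) : Matrix (Fin n) (Fin n) ℝ :=
  Matrix.of fun i j => inner ℝ (W (EuclideanSpace.single i 1)) (W (EuclideanSpace.single j 1))

theorem LinearMap.apply_eq_sum_single {T : Type*} [AddCommGroup T] [Module ℝ T]
    (W : EuclideanSpace ℝ (Fin n) →ₗ[ℝ] T)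
    (v : EuclideanSpace ℝ (Fin n)) : W v = ∑ i, v i • W (EuclideanSpace.single i 1) := by
  conv_lhs => rw [← (EuclideanSpace.basisFun (Fin n) ℝ).sum_repr v]
  simp

theorem inner_eq_sum_gramOf (W : EuclideanSpace ℝ (Fin n) →ₗ[ℝ] T)
    (v w : EuclideanSpace ℝ (Fin n)) :
    inner ℝ (W v) (W w) = ∑ i, ∑ j, v i * w j * gramOf W i j := by
  rw [W.apply_eq_sum_single v, W.apply_eq_sum_single w, sum_inner]
  refine Finset.sum_congr rfl fun i _ => ?_
  rw [inner_sum]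
  refine Finset.sum_congr rfl fun j _ => ?_
  rw [real_inner_smul_left, real_inner_smul_right, gramOf, Matrix.of_apply]
  ring

/-- The Gram matrix transforms as a quadratic form, `G(W B) = Bᵀ G(W) B`. This is the source of the
Jacobian factor relating the densities of two charts. -/
theorem det_gramOf_comp (W : EuclideanSpace ℝ (Fin n) →ₗ[ℝ] T)
    (B : EuclideanSpace ℝ (Fin n) →ₗ[ℝ] EuclideanSpace ℝ (Fin n)) :
    (gramOf (W ∘ₗ B)).det = LinearMap.det B ^ 2 * (gramOf W).det := by
  have hB := LinearMap.det_toMatrix (EuclideanSpace.basisFun (Fin n) ℝ).toBasis B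
  set b := (EuclideanSpace.basisFun (Fin n) ℝ).toBasis
  have h : gramOf (W ∘ₗ B) = (LinearMap.toMatrix b b B).transpose * gramOf W *
      LinearMap.toMatrix b b B := by
    ext i j
    have : gramOf (W ∘ₗ B) i j =
        inner ℝ (W (B (EuclideanSpace.single i 1))) (W (B (EuclideanSpace.single j 1))) := rfl
    rw [this, inner_eq_sum_gramOf]
    simp only [Matrix.mul_apply, Matrix.transpose_apply, LinearMap.toMatrix_apply, Finset.sum_mul]
    rw [Finset.sum_comm]
    refine Finset.sum_congr rfl fun k _ => Finset.sum_congr rfl fun l _ => ?_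
    simp [b]
    ring
  rw [h, Matrix.det_mul, Matrix.det_mul, Matrix.det_transpose, hB]
  ring

/-- The range of `W` is an `n`-dimensional inner product space, so an orthonormal basis identifies
it isometrically with `ℝⁿ`. Thus the metric at one point of a chart is written as `|S v|²`, and its
balls are ellipsoids. -/
theorem exists_linearEquiv_inner_eq (W : EuclideanSpace ℝ (Fin n) →ₗ[ℝ] T)
    (hW : Function.Injective W) :
    ∃ S : EuclideanSpace ℝ (Fin n) ≃L[ℝ] EuclideanSpace ℝ (Fin n),
      ∀ v w, inner ℝ (S v) (S w) = inner ℝ (W v) (W w) := by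
  have hfin : Module.finrank ℝ (LinearMap.range W) = n := by
    rw [LinearMap.finrank_range_of_inj hW]
    simp
  let b := (stdOrthonormalBasis ℝ (LinearMap.range W)).reindex (finCongr hfin)
  let e : EuclideanSpace ℝ (Fin n) ≃ₗ[ℝ] EuclideanSpace ℝ (Fin n) :=
    (LinearEquiv.ofInjective W hW).trans b.repr.toLinearEquiv
  refine ⟨e.toContinuousLinearEquiv, fun v w => ?_⟩
  change inner ℝ (b.repr (LinearEquiv.ofInjective W hW v))
    (b.repr (LinearEquiv.ofInjective W hW w)) = _
  rw [LinearIsometryEquiv.inner_map_map]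
  rfl

theorem det_gramOf_pos (W : EuclideanSpace ℝ (Fin n) →ₗ[ℝ] T) (hW : Function.Injective W) :
    0 < (gramOf W).det := by
  obtain ⟨S, hS⟩ := exists_linearEquiv_inner_eq W hW
  have h1 : gramOf W = gramOf ((LinearMap.id : EuclideanSpace ℝ (Fin n) →ₗ[ℝ] _) ∘ₗ
      (S.toLinearEquiv : EuclideanSpace ℝ (Fin n) →ₗ[ℝ] EuclideanSpace ℝ (Fin n))) := by
    ext i j
    exact (hS _ _).symm
  have h2 : gramOf (LinearMap.id : EuclideanSpace ℝ (Fin n) →ₗ[ℝ] EuclideanSpace ℝ (Fin n)) = 1 := by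
    ext i j
    simp [gramOf, Matrix.one_apply, EuclideanSpace.inner_single_left]
  rw [h1, det_gramOf_comp, h2, Matrix.det_one, mul_one]
  have := LinearEquiv.isUnit_det' S.toLinearEquiv
  exact sq_pos_of_ne_zero this.ne_zero

end Gram

/-! ### The metric tensor in charts. -/

section ChartDeriv

variable {n : ℕ} {M : Type*} [EMetricSpace M]
    [ChartedSpace (EuclideanSpace ℝ (Fin n)) M] [IsManifold (𝓡 n) ∞ M]
    [RiemannianBundle (fun x : M => TangentSpace (𝓡 n) x)]
    [IsContMDiffRiemannianBundle (𝓡 n) ∞ (EuclideanSpace ℝ (Fin n))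
      (fun x : M => TangentSpace (𝓡 n) x)]

variable (n M) in
theorem isContinuousRiemannianBundle_tangentSpace :
    IsContinuousRiemannianBundle (EuclideanSpace ℝ (Fin n))
      (fun x : M => TangentSpace (𝓡 n) x) := by
  obtain ⟨g, hg, h⟩ := (‹IsContMDiffRiemannianBundle (𝓡 n) ∞ (EuclideanSpace ℝ (Fin n))
      (fun x : M => TangentSpace (𝓡 n) x)›).exists_contMDiff
  exact ⟨g, hg.continuous, h⟩

/-- The differential of the inverse of the chart around `x`. -/
noncomputable def chartDeriv (n : ℕ) {M : Type*} [EMetricSpace M]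
    [ChartedSpace (EuclideanSpace ℝ (Fin n)) M] (x : M) (u : EuclideanSpace ℝ (Fin n)) :
    EuclideanSpace ℝ (Fin n) →L[ℝ] TangentSpace (𝓡 n) ((extChartAt (𝓡 n) x).symm u) :=
  mfderiv (𝓡 n) (𝓡 n) (extChartAt (𝓡 n) x).symm u

omit [IsManifold (𝓡 n) ∞ M] [IsContMDiffRiemannianBundle (𝓡 n) ∞ (EuclideanSpace ℝ (Fin n))
      (fun x : M => TangentSpace (𝓡 n) x)] in
theorem metricMatrix_eq_gramOf (x : M) (u : EuclideanSpace ℝ (Fin n)) :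
    metricMatrix M x u = gramOf (chartDeriv n x u).toLinearMap := rfl

omit [RiemannianBundle (fun x : M => TangentSpace (𝓡 n) x)]
  [IsContMDiffRiemannianBundle (𝓡 n) ∞ (EuclideanSpace ℝ (Fin n))
    (fun x : M => TangentSpace (𝓡 n) x)] in
theorem mdifferentiableAt_extChartAt_symm' (x : M) {u : EuclideanSpace ℝ (Fin n)}
    (hu : u ∈ (extChartAt (𝓡 n) x).target) :
    MDifferentiableAt (𝓡 n) (𝓡 n) (extChartAt (𝓡 n) x).symm u := by
  have := (contMDiffOn_extChartAt_symm (I := 𝓡 n) (n := ∞) x).mdifferentiableOn (by simp) u hu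
  exact this.mdifferentiableAt ((isOpen_extChartAt_target x).mem_nhds hu)

omit [RiemannianBundle (fun x : M => TangentSpace (𝓡 n) x)]
  [IsContMDiffRiemannianBundle (𝓡 n) ∞ (EuclideanSpace ℝ (Fin n))
    (fun x : M => TangentSpace (𝓡 n) x)] in
theorem injective_chartDeriv (x : M) {u : EuclideanSpace ℝ (Fin n)}
    (hu : u ∈ (extChartAt (𝓡 n) x).target) : Function.Injective (chartDeriv n x u) := by
  have h := isInvertible_mfderivWithin_extChartAt_symm (I := 𝓡 n) hu
  rw [show range (𝓡 n) = univ by simp, mfderivWithin_univ] at h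
  exact h.injective

omit [IsManifold (𝓡 n) ∞ M] [IsContMDiffRiemannianBundle (𝓡 n) ∞ (EuclideanSpace ℝ (Fin n))
      (fun x : M => TangentSpace (𝓡 n) x)] in
theorem gramOf_mfderiv_congr {k k' : EuclideanSpace ℝ (Fin n) → M} {u : EuclideanSpace ℝ (Fin n)}
    (h : k =ᶠ[𝓝 u] k') :
    gramOf (T := TangentSpace (𝓡 n) (k u)) (mfderiv (𝓡 n) (𝓡 n) k u).toLinearMap =
      gramOf (T := TangentSpace (𝓡 n) (k' u)) (mfderiv (𝓡 n) (𝓡 n) k' u).toLinearMap := by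
  -- The two derivatives land in tangent spaces at propositionally equal points. Viewing both as
  -- maps into the model space lets the equalities be substituted separately.
  have key : ∀ (z z' : M) (W W' : EuclideanSpace ℝ (Fin n) →L[ℝ] EuclideanSpace ℝ (Fin n)),
      z = z' → W = W' → gramOf (T := TangentSpace (𝓡 n) z) W.toLinearMap =
        gramOf (T := TangentSpace (𝓡 n) z') W'.toLinearMap := by
    rintro z _ W _ rfl rfl
    rfl
  exact key _ _ _ _ h.eq_of_nhds h.mfderiv_eq

omit [RiemannianBundle (fun x : M => TangentSpace (𝓡 n) x)]
  [IsContMDiffRiemannianBundle (𝓡 n) ∞ (EuclideanSpace ℝ (Fin n))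
    (fun x : M => TangentSpace (𝓡 n) x)] in
theorem differentiableAt_chart_transition (x y : M) {u : EuclideanSpace ℝ (Fin n)}
    (hu : u ∈ (extChartAt (𝓡 n) x).target)
    (huy : (extChartAt (𝓡 n) x).symm u ∈ (extChartAt (𝓡 n) y).source) :
    DifferentiableAt ℝ (extChartAt (𝓡 n) y ∘ (extChartAt (𝓡 n) x).symm) u := by
  rw [← mdifferentiableAt_iff_differentiableAt]
  refine MDifferentiableAt.comp u ?_ (mdifferentiableAt_extChartAt_symm' x hu)
  exact mdifferentiableAt_extChartAt (by simpa using huy)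

omit [IsContMDiffRiemannianBundle (𝓡 n) ∞ (EuclideanSpace ℝ (Fin n))
    (fun x : M => TangentSpace (𝓡 n) x)] in
/-- The chain rule for the differentials of two inverse charts. -/
theorem metricMatrix_eq_gramOf_comp (x y : M) {u : EuclideanSpace ℝ (Fin n)}
    (hu : u ∈ (extChartAt (𝓡 n) x).target)
    (huy : (extChartAt (𝓡 n) x).symm u ∈ (extChartAt (𝓡 n) y).source) :
    metricMatrix M x u =
      gramOf ((chartDeriv n y (extChartAt (𝓡 n) y ((extChartAt (𝓡 n) x).symm u))).toLinearMap ∘ₗ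
        (fderiv ℝ (extChartAt (𝓡 n) y ∘ (extChartAt (𝓡 n) x).symm) u).toLinearMap) := by
  have hcont : ContinuousAt (extChartAt (𝓡 n) x).symm u :=
    (continuousOn_extChartAt_symm x).continuousAt ((isOpen_extChartAt_target x).mem_nhds hu)
  have heq : (extChartAt (𝓡 n) x).symm =ᶠ[𝓝 u]
      ((extChartAt (𝓡 n) y).symm ∘ (extChartAt (𝓡 n) y ∘ (extChartAt (𝓡 n) x).symm)) := by
    filter_upwards [hcont.preimage_mem_nhds ((isOpen_extChartAt_source y).mem_nhds huy)] with w hw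
    exact ((extChartAt (𝓡 n) y).left_inv hw).symm
  have h1 := gramOf_mfderiv_congr heq
  refine h1.trans ?_
  have h2 : mfderiv (𝓡 n) (𝓡 n)
      ((extChartAt (𝓡 n) y).symm ∘ (extChartAt (𝓡 n) y ∘ (extChartAt (𝓡 n) x).symm)) u =
      (mfderiv (𝓡 n) (𝓡 n) (extChartAt (𝓡 n) y).symm
        (extChartAt (𝓡 n) y ((extChartAt (𝓡 n) x).symm u))).comp
        (mfderiv (𝓡 n) (𝓡 n) (extChartAt (𝓡 n) y ∘ (extChartAt (𝓡 n) x).symm) u) := by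
    refine mfderiv_comp u (mdifferentiableAt_extChartAt_symm' y
      ((extChartAt (𝓡 n) y).map_source huy)) ?_
    rw [mdifferentiableAt_iff_differentiableAt]
    exact differentiableAt_chart_transition x y hu huy
  rw [mfderiv_eq_fderiv] at h2
  rw [h2]
  rfl

/-- `g_ij` is the inner product of two coordinate vector fields; these are continuous sections
because the tangent map of the inverse chart is continuous. -/
theorem continuousOn_metricMatrix (x : M) (i j : Fin n) :
    ContinuousOn (fun u => metricMatrix M x u i j) (extChartAt (𝓡 n) x).target := by
  have hsec : ∀ i : Fin n, ContinuousOn (fun u => (⟨(extChartAt (𝓡 n) x).symm u,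
      chartDeriv n x u (EuclideanSpace.single i 1)⟩ : TangentBundle (𝓡 n) M))
      (extChartAt (𝓡 n) x).target := by
    intro i
    have h1 := (contMDiffOn_extChartAt_symm (I := 𝓡 n) (n := ∞) x).continuousOn_tangentMapWithin
      (by simp) (isOpen_extChartAt_target x).uniqueMDiffOn
    have h2 : Continuous fun u : EuclideanSpace ℝ (Fin n) =>
        (⟨u, EuclideanSpace.single i 1⟩ : TangentBundle (𝓡 n) (EuclideanSpace ℝ (Fin n))) := by
      have := (tangentBundleModelSpaceHomeomorph (𝓡 n)).symm.continuous.comp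
        (Continuous.prodMk (continuous_id (X := EuclideanSpace ℝ (Fin n)))
          (continuous_const (y := (EuclideanSpace.single i 1 : EuclideanSpace ℝ (Fin n)))))
      exact this
    have h3 := h1.comp (h2.continuousOn (s := (extChartAt (𝓡 n) x).target)) (fun u hu => hu)
    refine h3.congr fun u hu => ?_
    simp only [Function.comp, tangentMapWithin]
    rw [mfderivWithin_of_isOpen (isOpen_extChartAt_target x) hu]
    rfl
  have := isContinuousRiemannianBundle_tangentSpace n M
  exact ContinuousOn.inner_bundle (E := fun x : M => TangentSpace (𝓡 n) x) (hsec i) (hsec j)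

end ChartDeriv

/-! ### Riemannian volume and integration in charts. -/

section ChartVolume

variable {n : ℕ} {M : Type*} [EMetricSpace M]
    [ChartedSpace (EuclideanSpace ℝ (Fin n)) M] [IsManifold (𝓡 n) ∞ M]
    [RiemannianBundle (fun x : M => TangentSpace (𝓡 n) x)]
    [IsContMDiffRiemannianBundle (𝓡 n) ∞ (EuclideanSpace ℝ (Fin n))
      (fun x : M => TangentSpace (𝓡 n) x)]

omit [IsManifold (𝓡 n) ∞ M] [IsContMDiffRiemannianBundle (𝓡 n) ∞ (EuclideanSpace ℝ (Fin n))
      (fun x : M => TangentSpace (𝓡 n) x)] in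
/-- The density `√(det g_{ij})` in the chart around `x`. -/
noncomputable def chartDensity (x : M) (u : EuclideanSpace ℝ (Fin n)) : ℝ≥0∞ :=
  ENNReal.ofReal (Real.sqrt (metricMatrix M x u).det)

theorem continuousOn_chartDensity (x : M) :
    ContinuousOn (chartDensity x) (extChartAt (𝓡 n) x).target := by
  have h1 : ContinuousOn (fun u => metricMatrix M x u) (extChartAt (𝓡 n) x).target :=
    continuousOn_pi.2 fun i => continuousOn_pi.2 fun j => continuousOn_metricMatrix x i j
  have h2 : Continuous fun A : Matrix (Fin n) (Fin n) ℝ => ENNReal.ofReal (Real.sqrt A.det) :=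
    ENNReal.continuous_ofReal.comp (Real.continuous_sqrt.comp continuous_id.matrix_det)
  exact h2.comp_continuousOn h1

omit [IsContMDiffRiemannianBundle (𝓡 n) ∞ (EuclideanSpace ℝ (Fin n))
    (fun x : M => TangentSpace (𝓡 n) x)] in
theorem chartDensity_ne_zero (x : M) {u : EuclideanSpace ℝ (Fin n)}
    (hu : u ∈ (extChartAt (𝓡 n) x).target) : chartDensity x u ≠ 0 := by
  rw [chartDensity, metricMatrix_eq_gramOf]
  have := det_gramOf_pos _ (injective_chartDeriv x hu)
  exact (ENNReal.ofReal_pos.2 (Real.sqrt_pos.2 this)).ne'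

omit [IsManifold (𝓡 n) ∞ M] [IsContMDiffRiemannianBundle (𝓡 n) ∞ (EuclideanSpace ℝ (Fin n))
      (fun x : M => TangentSpace (𝓡 n) x)] in
theorem chartDensity_ne_top (x : M) (u : EuclideanSpace ℝ (Fin n)) : chartDensity x u ≠ ⊤ :=
  ENNReal.ofReal_ne_top

omit [IsContMDiffRiemannianBundle (𝓡 n) ∞ (EuclideanSpace ℝ (Fin n))
    (fun x : M => TangentSpace (𝓡 n) x)] in
theorem chartDensity_eq_mul (x y : M) {u : EuclideanSpace ℝ (Fin n)}
    (hu : u ∈ (extChartAt (𝓡 n) x).target)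
    (huy : (extChartAt (𝓡 n) x).symm u ∈ (extChartAt (𝓡 n) y).source) :
    chartDensity x u =
      ENNReal.ofReal |(fderiv ℝ (extChartAt (𝓡 n) y ∘ (extChartAt (𝓡 n) x).symm) u).det| *
        chartDensity y ((extChartAt (𝓡 n) y ∘ (extChartAt (𝓡 n) x).symm) u) := by
  rw [chartDensity, metricMatrix_eq_gramOf_comp x y hu huy, det_gramOf_comp,
    Real.sqrt_mul (sq_nonneg _), Real.sqrt_sq_eq_abs, ENNReal.ofReal_mul (abs_nonneg _)]
  rfl

variable [MeasurableSpace M] [BorelSpace M]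

omit [IsManifold (𝓡 n) ∞ M] [RiemannianBundle (fun x : M => TangentSpace (𝓡 n) x)]
  [IsContMDiffRiemannianBundle (𝓡 n) ∞ (EuclideanSpace ℝ (Fin n))
    (fun x : M => TangentSpace (𝓡 n) x)] in
theorem measurableSet_target_inter_preimage (x : M) {S : Set M} (hS : MeasurableSet S) :
    MeasurableSet ((extChartAt (𝓡 n) x).target ∩ (extChartAt (𝓡 n) x).symm ⁻¹' S) := by
  have h := (isOpen_extChartAt_target (I := 𝓡 n) x).measurableSet
  have hm : Measurable ((extChartAt (𝓡 n) x).target.domRestrict (extChartAt (𝓡 n) x).symm) :=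
    (continuousOn_iff_continuous_domRestrict.1 (continuousOn_extChartAt_symm x)).measurable
  have := h.subtype_image (hm hS)
  convert this using 1
  ext u
  simp [domRestrict_apply, and_comm]

omit [IsManifold (𝓡 n) ∞ M] [RiemannianBundle (fun x : M => TangentSpace (𝓡 n) x)]
  [IsContMDiffRiemannianBundle (𝓡 n) ∞ (EuclideanSpace ℝ (Fin n))
    (fun x : M => TangentSpace (𝓡 n) x)] in
theorem measurableSet_source_inter_preimage (x : M) {Z : Set (EuclideanSpace ℝ (Fin n))}
    (hZ : MeasurableSet Z) :
    MeasurableSet ((extChartAt (𝓡 n) x).source ∩ extChartAt (𝓡 n) x ⁻¹' Z) := by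
  have h := (isOpen_extChartAt_source (I := 𝓡 n) x).measurableSet
  have hm : Measurable ((extChartAt (𝓡 n) x).source.domRestrict (extChartAt (𝓡 n) x)) :=
    (continuousOn_iff_continuous_domRestrict.1 (continuousOn_extChartAt x)).measurable
  have := h.subtype_image (hm hZ)
  convert this using 1
  ext u
  simp [domRestrict_apply, and_comm]

omit [IsManifold (𝓡 n) ∞ M] [IsContMDiffRiemannianBundle (𝓡 n) ∞ (EuclideanSpace ℝ (Fin n))
      (fun x : M => TangentSpace (𝓡 n) x)] in
theorem aemeasurable_extChartAt_symm (x : M) :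
    AEMeasurable (extChartAt (𝓡 n) x).symm
      ((volume.restrict (extChartAt (𝓡 n) x).target).withDensity (chartDensity x)) :=
  ((continuousOn_extChartAt_symm x).aemeasurable
    (isOpen_extChartAt_target x).measurableSet).mono_ac (withDensity_absolutelyContinuous _ _)

omit [IsManifold (𝓡 n) ∞ M] [IsContMDiffRiemannianBundle (𝓡 n) ∞ (EuclideanSpace ℝ (Fin n))
      (fun x : M => TangentSpace (𝓡 n) x)] in
theorem chartVolume_apply (x : M) {S : Set M} (hS : MeasurableSet S) :
    chartVolume (n := n) M x S =
      ∫⁻ u in (extChartAt (𝓡 n) x).target ∩ (extChartAt (𝓡 n) x).symm ⁻¹' S, chartDensity x u := by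
  have h := aemeasurable_extChartAt_symm (n := n) x
  rw [chartVolume]
  change Measure.map _ ((volume.restrict (extChartAt (𝓡 n) x).target).withDensity
    (chartDensity x)) S = _
  rw [Measure.map_apply_of_aemeasurable h hS, withDensity_apply',
    Measure.restrict_restrict' (isOpen_extChartAt_target x).measurableSet, inter_comm]

omit [IsContMDiffRiemannianBundle (𝓡 n) ∞ (EuclideanSpace ℝ (Fin n))
    (fun x : M => TangentSpace (𝓡 n) x)] in
-- Change of variables along the transition map `τ`, whose Jacobian is exactly the ratio of the two
-- densities by `chartDensity_eq_mul`.
theorem chartVolume_eq_of_subset (x y : M) {S : Set M} (hS : MeasurableSet S)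
    (hx : S ⊆ (extChartAt (𝓡 n) x).source) (hy : S ⊆ (extChartAt (𝓡 n) y).source) :
    chartVolume (n := n) M x S = chartVolume (n := n) M y S := by
  rw [chartVolume_apply x hS, chartVolume_apply y hS]
  set τ := extChartAt (𝓡 n) y ∘ (extChartAt (𝓡 n) x).symm with hτ
  have himg : (extChartAt (𝓡 n) y).target ∩ (extChartAt (𝓡 n) y).symm ⁻¹' S =
      τ '' ((extChartAt (𝓡 n) x).target ∩ (extChartAt (𝓡 n) x).symm ⁻¹' S) := by
    ext w
    constructor
    · rintro ⟨hw, hwS⟩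
      refine ⟨extChartAt (𝓡 n) x ((extChartAt (𝓡 n) y).symm w),
        ⟨(extChartAt (𝓡 n) x).map_source (hx hwS), ?_⟩, ?_⟩
      · rw [mem_preimage, (extChartAt (𝓡 n) x).left_inv (hx hwS)]
        exact hwS
      · rw [hτ, Function.comp, (extChartAt (𝓡 n) x).left_inv (hx hwS),
          (extChartAt (𝓡 n) y).right_inv hw]
    · rintro ⟨u, ⟨hu, huS⟩, rfl⟩
      refine ⟨(extChartAt (𝓡 n) y).map_source (hy huS), ?_⟩
      rw [mem_preimage, hτ, Function.comp, (extChartAt (𝓡 n) y).left_inv (hy huS)]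
      exact huS
  have hinj : InjOn τ ((extChartAt (𝓡 n) x).target ∩ (extChartAt (𝓡 n) x).symm ⁻¹' S) := by
    rintro u ⟨hu, huS⟩ w ⟨hw, hwS⟩ h
    exact (extChartAt (𝓡 n) x).symm.injOn hu hw
      ((extChartAt (𝓡 n) y).injOn (hy huS) (hy hwS) h)
  rw [himg, lintegral_image_eq_lintegral_abs_det_fderiv_mul volume
    (measurableSet_target_inter_preimage x hS)
    (fun u hu => (differentiableAt_chart_transition x y hu.1 (hy hu.2)).hasFDerivAt.hasFDerivWithinAt)
    hinj]
  exact setLIntegral_congr_fun (measurableSet_target_inter_preimage x hS)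
    fun u hu => chartDensity_eq_mul x y hu.1 (hy hu.2)

omit [IsManifold (𝓡 n) ∞ M] [IsContMDiffRiemannianBundle (𝓡 n) ∞ (EuclideanSpace ℝ (Fin n))
      (fun x : M => TangentSpace (𝓡 n) x)] in
theorem chartVolume_inter_source (x : M) {S : Set M} (hS : MeasurableSet S) :
    chartVolume (n := n) M x (S ∩ (extChartAt (𝓡 n) x).source) = chartVolume (n := n) M x S := by
  rw [chartVolume_apply x hS,
    chartVolume_apply x (hS.inter (isOpen_extChartAt_source x).measurableSet)]
  congr 2
  ext u
  simp only [mem_inter_iff, mem_preimage]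
  exact ⟨fun h => ⟨h.1, h.2.1⟩, fun h => ⟨h.1, h.2, (extChartAt (𝓡 n) x).map_target h.1⟩⟩

omit [IsManifold (𝓡 n) ∞ M] [RiemannianBundle (fun x : M => TangentSpace (𝓡 n) x)]
  [IsContMDiffRiemannianBundle (𝓡 n) ∞ (EuclideanSpace ℝ (Fin n))
    (fun x : M => TangentSpace (𝓡 n) x)] in
variable (n M) in
/-- A second countable manifold is partitioned into countably many Borel subsets of chart
domains. -/
theorem exists_partition_subset_chart_source [SecondCountableTopology M] [Nonempty M] :
    ∃ (c : ℕ → M) (B : ℕ → Set M), (∀ k, MeasurableSet (B k)) ∧ Pairwise (Function.onFun Disjoint B) ∧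
      ⋃ k, B k = univ ∧ ∀ k, B k ⊆ (extChartAt (𝓡 n) (c k)).source := by
  obtain ⟨s, hs, hcov⟩ := TopologicalSpace.countable_cover_nhds
    (fun x : M => extChartAt_source_mem_nhds (I := 𝓡 n) x)
  have hne : s.Nonempty := by
    rcases s.eq_empty_or_nonempty with rfl | h
    · rw [biUnion_empty] at hcov
      exact absurd hcov empty_ne_univ
    · exact h
  obtain ⟨c, rfl⟩ := hs.exists_eq_range hne
  refine ⟨c, disjointed fun k => (extChartAt (𝓡 n) (c k)).source, ?_, disjoint_disjointed _, ?_, ?_⟩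
  · exact MeasurableSet.disjointed fun k => (isOpen_extChartAt_source (c k)).measurableSet
  · rw [iUnion_disjointed]
    simpa using hcov
  · exact fun k => disjointed_subset _ k

omit [IsContMDiffRiemannianBundle (𝓡 n) ∞ (EuclideanSpace ℝ (Fin n))
    (fun x : M => TangentSpace (𝓡 n) x)] in
-- A supremum of measures is not computed set by set. The upper bound comes from an explicit measure
-- dominating every chart volume, glued from chart volumes on the pieces of a countable partition.
theorem riemannianVolume_apply_of_subset [SecondCountableTopology M] (x : M) {S : Set M}
    (hS : MeasurableSet S) (hx : S ⊆ (extChartAt (𝓡 n) x).source) :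
    riemannianVolume (n := n) M S = chartVolume (n := n) M x S := by
  have : Nonempty M := ⟨x⟩
  obtain ⟨c, B, hBm, hBd, hBu, hBc⟩ := exists_partition_subset_chart_source n M
  refine le_antisymm ?_ (le_iSup (fun x : M => chartVolume (n := n) M x) x S)
  have hdecomp : ∀ (ν : Measure M) {S : Set M}, MeasurableSet S → ν S = ∑' k, ν (S ∩ B k) := by
    intro ν S hS
    conv_lhs => rw [← inter_univ S, ← hBu, inter_iUnion]
    exact measure_iUnion (fun i j hij => (hBd hij).mono inter_subset_right inter_subset_right)
      fun k => hS.inter (hBm k)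
  have hle : riemannianVolume (n := n) M ≤
      Measure.sum fun k => (chartVolume (n := n) M (c k)).restrict (B k) := by
    refine iSup_le fun y => Measure.le_iff.2 fun S hS => ?_
    rw [Measure.sum_apply _ hS, hdecomp _ hS]
    refine ENNReal.tsum_le_tsum fun k => ?_
    rw [Measure.restrict_apply hS, ← chartVolume_inter_source y (hS.inter (hBm k)),
      chartVolume_eq_of_subset y (c k)
        ((hS.inter (hBm k)).inter (isOpen_extChartAt_source y).measurableSet) inter_subset_right
        (inter_subset_left.trans (inter_subset_right.trans (hBc k)))]
    exact measure_mono inter_subset_left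
  refine (hle S).trans ?_
  rw [Measure.sum_apply _ hS, hdecomp (chartVolume (n := n) M x) hS]
  refine ENNReal.tsum_le_tsum fun k => ?_
  rw [Measure.restrict_apply hS, chartVolume_eq_of_subset x (c k) (hS.inter (hBm k))
    (inter_subset_left.trans hx) (inter_subset_right.trans (hBc k))]

/-- Integration with respect to the Riemannian volume in a chart. -/
theorem setLIntegral_riemannianVolume [SecondCountableTopology M] (x : M) {S : Set M}
    (hS : MeasurableSet S) (hx : S ⊆ (extChartAt (𝓡 n) x).source) {h : M → ℝ≥0∞}
    (hh : AEMeasurable h ((riemannianVolume (n := n) M).restrict S)) :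
    ∫⁻ z in S, h z ∂(riemannianVolume (n := n) M) =
      ∫⁻ u in (extChartAt (𝓡 n) x).target ∩ (extChartAt (𝓡 n) x).symm ⁻¹' S,
        chartDensity x u * h ((extChartAt (𝓡 n) x).symm u) := by
  have hres : (riemannianVolume (n := n) M).restrict S = (chartVolume (n := n) M x).restrict S := by
    ext R hR
    rw [Measure.restrict_apply hR, Measure.restrict_apply hR,
      riemannianVolume_apply_of_subset x (hR.inter hS) (inter_subset_right.trans hx)]
  have hT := (isOpen_extChartAt_target (I := 𝓡 n) x).measurableSet
  have hTS := measurableSet_target_inter_preimage (n := n) x hS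
  have hae : AEMeasurable (extChartAt (𝓡 n) x).symm
    ((volume.restrict ((extChartAt (𝓡 n) x).target ∩
      (extChartAt (𝓡 n) x).symm ⁻¹' S)).withDensity (chartDensity x)) := by
    exact (((continuousOn_extChartAt_symm x).mono inter_subset_left).aemeasurable
      hTS).mono_ac (withDensity_absolutelyContinuous _ _)
  have hmap : (riemannianVolume (n := n) M).restrict S =
      ((volume.restrict ((extChartAt (𝓡 n) x).target ∩
        (extChartAt (𝓡 n) x).symm ⁻¹' S)).withDensity (chartDensity x)).map
        (extChartAt (𝓡 n) x).symm := by
    ext R hR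
    rw [hres, Measure.restrict_apply hR, chartVolume_apply x (hR.inter hS),
      Measure.map_apply_of_aemeasurable hae hR, withDensity_apply',
      Measure.restrict_restrict' hTS]
    congr 2
    ext u
    simp only [mem_inter_iff, mem_preimage]
    tauto
  rw [hmap] at hh ⊢
  rw [lintegral_map' hh hae]
  have hd : AEMeasurable (chartDensity x) (volume.restrict ((extChartAt (𝓡 n) x).target ∩
        (extChartAt (𝓡 n) x).symm ⁻¹' S)) :=
    ((continuousOn_chartDensity x).mono inter_subset_left).aemeasurable hTS
  rw [lintegral_withDensity_eq_lintegral_mul_non_measurable₀ _ hd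
    (Eventually.of_forall fun u => (chartDensity_ne_top x u).lt_top)]
  rfl

omit [IsContMDiffRiemannianBundle (𝓡 n) ∞ (EuclideanSpace ℝ (Fin n))
    (fun x : M => TangentSpace (𝓡 n) x)] in
theorem riemannianVolume_eq_setLIntegral [SecondCountableTopology M] (x : M) {S : Set M}
    (hS : MeasurableSet S) (hx : S ⊆ (extChartAt (𝓡 n) x).source) :
    riemannianVolume (n := n) M S =
      ∫⁻ u in (extChartAt (𝓡 n) x).target ∩ (extChartAt (𝓡 n) x).symm ⁻¹' S, chartDensity x u := by
  rw [riemannianVolume_apply_of_subset x hS hx, chartVolume_apply x hS]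

omit [IsContMDiffRiemannianBundle (𝓡 n) ∞ (EuclideanSpace ℝ (Fin n))
    (fun x : M => TangentSpace (𝓡 n) x)] in
/-- The inverse charts map Lebesgue null sets to null sets. -/
theorem riemannianVolume_image_symm_eq_zero [SecondCountableTopology M] (x : M)
    {Z : Set (EuclideanSpace ℝ (Fin n))} (hZ : Z ⊆ (extChartAt (𝓡 n) x).target)
    (h0 : volume Z = 0) :
    riemannianVolume (n := n) M ((extChartAt (𝓡 n) x).symm '' Z) = 0 := by
  obtain ⟨Z', hZZ', hZ'm, hZ'0⟩ := exists_measurable_superset_of_null h0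
  have hs := measurableSet_source_inter_preimage (n := n) x hZ'm
  refine measure_mono_null (t := (extChartAt (𝓡 n) x).source ∩ extChartAt (𝓡 n) x ⁻¹' Z') ?_ ?_
  · rintro _ ⟨u, hu, rfl⟩
    refine ⟨(extChartAt (𝓡 n) x).map_target (hZ hu), ?_⟩
    rw [mem_preimage, (extChartAt (𝓡 n) x).right_inv (hZ hu)]
    exact hZZ' hu
  · rw [riemannianVolume_eq_setLIntegral x hs inter_subset_left]
    refine setLIntegral_measure_zero _ _ (measure_mono_null ?_ hZ'0)
    rintro u ⟨hu, -, hu2⟩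
    rwa [mem_preimage, (extChartAt (𝓡 n) x).right_inv hu] at hu2

/-- The charts map null sets to Lebesgue null sets. -/
theorem volume_target_inter_preimage_eq_zero [SecondCountableTopology M] (x : M) {S : Set M}
    (hx : S ⊆ (extChartAt (𝓡 n) x).source) (h0 : riemannianVolume (n := n) M S = 0) :
    volume ((extChartAt (𝓡 n) x).target ∩ (extChartAt (𝓡 n) x).symm ⁻¹' S) = 0 := by
  obtain ⟨S', hSS', hS'm, hS'0⟩ := exists_measurable_superset_of_null h0
  have hsrc := (isOpen_extChartAt_source (I := 𝓡 n) x).measurableSet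
  have h1 : riemannianVolume (n := n) M (S' ∩ (extChartAt (𝓡 n) x).source) = 0 :=
    measure_mono_null inter_subset_left hS'0
  rw [riemannianVolume_eq_setLIntegral x (hS'm.inter hsrc) inter_subset_right] at h1
  have hm := measurableSet_target_inter_preimage (n := n) x (hS'm.inter hsrc)
  have hd : AEMeasurable (chartDensity x) (volume.restrict ((extChartAt (𝓡 n) x).target ∩
        (extChartAt (𝓡 n) x).symm ⁻¹' (S' ∩ (extChartAt (𝓡 n) x).source))) :=
    ((continuousOn_chartDensity x).mono inter_subset_left).aemeasurable hm
  rw [lintegral_eq_zero_iff' hd] at h1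
  have h2 : ∀ᵐ u ∂(volume.restrict ((extChartAt (𝓡 n) x).target ∩
        (extChartAt (𝓡 n) x).symm ⁻¹' (S' ∩ (extChartAt (𝓡 n) x).source))), False := by
    filter_upwards [h1, ae_restrict_mem hm] with u h hu
    exact chartDensity_ne_zero x hu.1 h
  rw [ae_iff] at h2
  simp only [not_false_eq_true, ofPred_true, Measure.restrict_apply_univ] at h2
  refine measure_mono_null ?_ h2
  exact fun u hu => ⟨hu.1, hSS' hu.2, hx hu.2⟩

end ChartVolume

/-! ### Geodesic distance compared with the Euclidean norm `‖S ·‖` in a chart. -/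

section BallComparison

variable {n : ℕ} {M : Type*} [EMetricSpace M]
    [ChartedSpace (EuclideanSpace ℝ (Fin n)) M] [IsManifold (𝓡 n) ∞ M]
    [RiemannianBundle (fun x : M => TangentSpace (𝓡 n) x)]
    [IsContMDiffRiemannianBundle (𝓡 n) ∞ (EuclideanSpace ℝ (Fin n))
      (fun x : M => TangentSpace (𝓡 n) x)]

/-- The norms `|·|_{g(u)}` in a chart depend continuously on `u`. -/
theorem eventually_norm_chartDeriv_le (x : M) {u₀ : EuclideanSpace ℝ (Fin n)}
    (hu₀ : u₀ ∈ (extChartAt (𝓡 n) x).target)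
    {S : EuclideanSpace ℝ (Fin n) ≃L[ℝ] EuclideanSpace ℝ (Fin n)}
    (hS : ∀ v w, inner ℝ (S v) (S w) = inner ℝ (chartDeriv n x u₀ v) (chartDeriv n x u₀ w))
    {δ : ℝ} (hδ : 1 < δ) :
    ∀ᶠ u in 𝓝 u₀, ∀ v, ‖chartDeriv n x u v‖ ≤ δ * ‖S v‖ ∧ ‖S v‖ ≤ δ * ‖chartDeriv n x u v‖ := by
  set C : ℝ := ‖(S.symm : EuclideanSpace ℝ (Fin n) →L[ℝ] EuclideanSpace ℝ (Fin n))‖ with hC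
  have hCv : ∀ v, ‖v‖ ≤ C * ‖S v‖ := fun v => by
    have := (S.symm : EuclideanSpace ℝ (Fin n) →L[ℝ] EuclideanSpace ℝ (Fin n)).le_opNorm (S v)
    simpa using this
  -- Chosen so that `1 - κ = δ⁻²` and `1 + κ ≤ δ²`: a relative error `κ` in the squared norms then
  -- gives the factor `δ` both ways.
  set κ : ℝ := 1 - (δ ^ 2)⁻¹ with hκ
  have hδ2 : 1 < δ ^ 2 := by nlinarith
  have hκ0 : 0 < κ := by
    have : (δ ^ 2)⁻¹ < 1 := inv_lt_one_of_one_lt₀ hδ2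
    linarith
  -- There are `n²` entries and `‖v‖ ≤ C ‖S v‖`, so the error is at most `n² C² η ‖S v‖²`; the `+ 1`
  -- avoids division by zero.
  set η : ℝ := κ / (n ^ 2 * C ^ 2 + 1) with hη
  have hη0 : 0 < η := by positivity
  have hev : ∀ᶠ u in 𝓝 u₀, ∀ i j, |metricMatrix M x u i j - metricMatrix M x u₀ i j| < η := by
    rw [eventually_all]
    intro i
    rw [eventually_all]
    intro j
    have h := (continuousOn_metricMatrix x i j).continuousAt
      ((isOpen_extChartAt_target x).mem_nhds hu₀)
    exact Metric.tendsto_nhds.1 h η hη0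
  filter_upwards [hev] with u hu v
  have h1 : ‖chartDeriv n x u v‖ ^ 2 = ∑ i, ∑ j, v i * v j * metricMatrix M x u i j := by
    rw [← real_inner_self_eq_norm_sq]
    exact inner_eq_sum_gramOf (chartDeriv n x u).toLinearMap v v
  have h2 : ‖S v‖ ^ 2 = ∑ i, ∑ j, v i * v j * metricMatrix M x u₀ i j := by
    rw [← real_inner_self_eq_norm_sq, hS]
    exact inner_eq_sum_gramOf (chartDeriv n x u₀).toLinearMap v v
  have h3 : |‖chartDeriv n x u v‖ ^ 2 - ‖S v‖ ^ 2| ≤ κ * ‖S v‖ ^ 2 := by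
    have h12 : ‖chartDeriv n x u v‖ ^ 2 - ‖S v‖ ^ 2 = ∑ i, (∑ j, v i * v j * metricMatrix M x u i j -
        ∑ j, v i * v j * metricMatrix M x u₀ i j) := by
      rw [h1, h2, ← Finset.sum_sub_distrib]
    rw [h12]
    have hb : ∀ i : Fin n, |v i| ≤ ‖v‖ := fun i => by
      simpa using PiLp.norm_apply_le v i
    calc |∑ i, (∑ j, v i * v j * metricMatrix M x u i j -
          ∑ j, v i * v j * metricMatrix M x u₀ i j)|
        ≤ ∑ i : Fin n, ∑ j : Fin n, ‖v‖ ^ 2 * η := by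
          refine (Finset.abs_sum_le_sum_abs _ _).trans (Finset.sum_le_sum fun i _ => ?_)
          rw [← Finset.sum_sub_distrib]
          refine (Finset.abs_sum_le_sum_abs _ _).trans (Finset.sum_le_sum fun j _ => ?_)
          rw [← mul_sub, abs_mul, abs_mul, sq]
          exact mul_le_mul (mul_le_mul (hb i) (hb j) (abs_nonneg _) (norm_nonneg _))
            (hu i j).le (abs_nonneg _) (by positivity)
      _ = n ^ 2 * η * ‖v‖ ^ 2 := by simp; ring
      _ ≤ n ^ 2 * η * (C * ‖S v‖) ^ 2 := by gcongr; exact hCv v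
      _ = (n ^ 2 * C ^ 2 * η) * ‖S v‖ ^ 2 := by ring
      _ ≤ κ * ‖S v‖ ^ 2 := by
          gcongr
          rw [hη, mul_div_assoc', div_le_iff₀ (by positivity)]
          nlinarith
  rw [abs_le] at h3
  have hδ0 : (0 : ℝ) < δ := by linarith
  have hδκ : δ ^ 2 * (1 - κ) = 1 := by
    rw [hκ]
    field_simp
    ring
  constructor
  · refine abs_le_of_sq_le_sq' ?_ (by positivity) |>.2
    rw [mul_pow]
    have : 1 + κ ≤ δ ^ 2 := by nlinarith
    nlinarith [sq_nonneg ‖S v‖, mul_le_mul_of_nonneg_right this (sq_nonneg ‖S v‖)]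
  · refine abs_le_of_sq_le_sq' ?_ (by positivity) |>.2
    rw [mul_pow]
    have : (1 - κ) * ‖S v‖ ^ 2 ≤ ‖chartDeriv n x u v‖ ^ 2 := by linarith
    have := mul_le_mul_of_nonneg_left this (sq_nonneg δ)
    rwa [← mul_assoc, hδκ, one_mul] at this

variable [IsRiemannianManifold (𝓡 n) M]

/-- The straight segment from `u₀` to `u` in the chart is an admissible path, with speed at most `δ
‖S (u - u₀)‖`. -/
theorem eventually_edist_extChartAt_symm_le (x : M) {u₀ : EuclideanSpace ℝ (Fin n)}
    (hu₀ : u₀ ∈ (extChartAt (𝓡 n) x).target)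
    {S : EuclideanSpace ℝ (Fin n) ≃L[ℝ] EuclideanSpace ℝ (Fin n)}
    (hS : ∀ v w, inner ℝ (S v) (S w) = inner ℝ (chartDeriv n x u₀ v) (chartDeriv n x u₀ w))
    {δ : ℝ} (hδ : 1 < δ) :
    ∀ᶠ u in 𝓝 u₀, edist ((extChartAt (𝓡 n) x).symm u₀) ((extChartAt (𝓡 n) x).symm u) ≤
      ENNReal.ofReal (δ * ‖S (u - u₀)‖) := by
  obtain ⟨r, hr, hball⟩ := Metric.mem_nhds_iff.1 (inter_mem
    ((isOpen_extChartAt_target (I := 𝓡 n) x).mem_nhds hu₀)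
    (eventually_norm_chartDeriv_le x hu₀ hS hδ))
  filter_upwards [Metric.ball_mem_nhds u₀ hr] with u hu
  set φ := (extChartAt (𝓡 n) x).symm with hφ
  let η : ℝ → EuclideanSpace ℝ (Fin n) := AffineMap.lineMap u₀ u
  have hηd : ∀ t, HasDerivAt η (u - u₀) t := fun t => AffineMap.hasDerivAt_lineMap
  have hηball : ∀ t ∈ Icc (0 : ℝ) 1, η t ∈ Metric.ball u₀ r := by
    intro t ht
    refine (convex_ball u₀ r).segment_subset (Metric.mem_ball_self hr) hu ?_
    rw [segment_eq_image_lineMap]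
    exact ⟨t, ht, rfl⟩
  have hηs : ContMDiff 𝓘(ℝ, ℝ) (𝓡 n) 1 η := by
    rw [contMDiff_iff_contDiff]
    have := (ContinuousAffineMap.lineMap (R := ℝ) u₀ u).contDiff (n := 1)
    rwa [ContinuousAffineMap.coe_lineMap_eq] at this
  have hlen : edist (φ u₀) (φ u) ≤ Manifold.pathELength (𝓡 n) (φ ∘ η) 0 1 := by
    rw [IsRiemannianManifold.out (I := 𝓡 n) (φ u₀) (φ u)]
    refine Manifold.riemannianEDist_le_pathELength ?_ (by simp [η]) (by simp [η]) zero_le_one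
    exact (contMDiffOn_extChartAt_symm x).comp hηs.contMDiffOn fun t ht => (hball (hηball t ht)).1
  refine hlen.trans ?_
  rw [Manifold.pathELength_eq_lintegral_mfderiv_Icc]
  calc ∫⁻ t in Icc (0 : ℝ) 1, ‖mfderiv 𝓘(ℝ, ℝ) (𝓡 n) (φ ∘ η) t 1‖ₑ
      ≤ ∫⁻ t in Icc (0 : ℝ) 1, ENNReal.ofReal (δ * ‖S (u - u₀)‖) := by
        refine setLIntegral_mono' measurableSet_Icc fun t ht => ?_
        have hb := hball (hηball t ht)
        have hcomp : mfderiv 𝓘(ℝ, ℝ) (𝓡 n) (φ ∘ η) t =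
            (mfderiv (𝓡 n) (𝓡 n) φ (η t)).comp (mfderiv 𝓘(ℝ, ℝ) (𝓡 n) η t) :=
          mfderiv_comp t (mdifferentiableAt_extChartAt_symm' x hb.1)
            (hηs.mdifferentiable one_ne_zero t)
        have h1 : mfderiv 𝓘(ℝ, ℝ) (𝓡 n) (φ ∘ η) t 1 = chartDeriv n x (η t) (u - u₀) := by
          rw [hcomp]
          have : mfderiv 𝓘(ℝ, ℝ) (𝓡 n) η t 1 = u - u₀ := by
            rw [mfderiv_eq_fderiv]
            exact (hηd t).deriv
          change mfderiv (𝓡 n) (𝓡 n) φ (η t) (mfderiv 𝓘(ℝ, ℝ) (𝓡 n) η t 1) = _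
          rw [this]
          rfl
        rw [h1, ← ofReal_norm]
        exact ENNReal.ofReal_le_ofReal (hb.2 _).1
    _ = ENNReal.ofReal (δ * ‖S (u - u₀)‖) := by simp

/-- Any sufficiently short path from the centre to `y` stays in the chart, and its image under `S ∘
φ` is at most `δ` times as long. -/
theorem eventually_norm_extChartAt_sub_le (x : M) {u₀ : EuclideanSpace ℝ (Fin n)}
    (hu₀ : u₀ ∈ (extChartAt (𝓡 n) x).target)
    {S : EuclideanSpace ℝ (Fin n) ≃L[ℝ] EuclideanSpace ℝ (Fin n)}
    (hS : ∀ v w, inner ℝ (S v) (S w) = inner ℝ (chartDeriv n x u₀ v) (chartDeriv n x u₀ w))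
    {δ : ℝ} (hδ : 1 < δ) :
    ∀ᶠ y in 𝓝 ((extChartAt (𝓡 n) x).symm u₀),
      ENNReal.ofReal ‖S (extChartAt (𝓡 n) x y - u₀)‖ ≤
        ENNReal.ofReal δ * edist ((extChartAt (𝓡 n) x).symm u₀) y := by
  set φ := extChartAt (𝓡 n) x with hφ
  have hsrc : φ.symm u₀ ∈ φ.source := φ.map_target hu₀
  have hcont : ContinuousAt φ (φ.symm u₀) := (continuousOn_extChartAt x).continuousAt
    ((isOpen_extChartAt_source x).mem_nhds hsrc)
  have hK : ∀ᶠ z in 𝓝 (φ.symm u₀), z ∈ φ.source ∧ ∀ w : TangentSpace (𝓡 n) z,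
      ‖S (mfderiv (𝓡 n) (𝓡 n) φ z w)‖ ≤ δ * ‖w‖ := by
    have hev := eventually_norm_chartDeriv_le x hu₀ hS hδ
    rw [← φ.right_inv hu₀] at hev
    filter_upwards [hcont.eventually hev, (isOpen_extChartAt_source x).mem_nhds hsrc] with z hz hzs
    refine ⟨hzs, ?_⟩
    obtain ⟨u, hu, rfl⟩ : ∃ u ∈ φ.target, φ.symm u = z :=
      ⟨φ z, φ.map_source hzs, φ.left_inv hzs⟩
    intro w
    rw [φ.right_inv hu] at hz
    have hid := mfderivWithin_extChartAt_symm_comp_mfderiv_extChartAt (I := 𝓡 n) hu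
    rw [show range (𝓡 n) = univ by simp, mfderivWithin_univ] at hid
    have h1 := (hz (mfderiv (𝓡 n) (𝓡 n) φ (φ.symm u) w)).2
    have h2 : chartDeriv n x u (mfderiv (𝓡 n) (𝓡 n) φ (φ.symm u) w) = w := congr($hid w)
    rwa [h2] at h1
  obtain ⟨ρ, hρ, hball⟩ := EMetric.mem_nhds_iff.1 hK
  filter_upwards [Metric.eball_mem_nhds _ hρ] with y hy
  rw [Metric.mem_eball, edist_comm] at hy
  -- A minimizing path need not exist; `c` leaves room for a path of length less than `c`, and `c`
  -- later decreases to the distance.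
  have hstep : ∀ c, edist (φ.symm u₀) y < c → c < ρ →
      ENNReal.ofReal ‖S (φ y - u₀)‖ ≤ ENNReal.ofReal δ * c := by
    intro c hc hcρ
    rw [IsRiemannianManifold.out (I := 𝓡 n) (φ.symm u₀) y] at hc
    obtain ⟨γ, hγ0, hγ1, hγs, hγlen, -⟩ :=
      Manifold.exists_lt_locally_constant_of_riemannianEDist_lt hc zero_lt_one
    -- Every initial arc has length less than `ρ`, so the path cannot leave the ball on which the
    -- derivative bound holds.
    have hγball : ∀ t ∈ Icc (0 : ℝ) 1, γ t ∈ Metric.eball (φ.symm u₀) ρ := by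
      intro t ht
      rw [Metric.mem_eball, edist_comm, IsRiemannianManifold.out (I := 𝓡 n) (φ.symm u₀) (γ t)]
      have h1 := Manifold.riemannianEDist_le_pathELength (hγs.contMDiffOn (s := Icc 0 t)) hγ0 rfl ht.1
      exact (h1.trans (Manifold.pathELength_mono le_rfl ht.2)).trans_lt (hγlen.trans hcρ)
    set h : ℝ → EuclideanSpace ℝ (Fin n) := fun t => S (φ (γ t)) with hh
    have hφγ : ContMDiffOn 𝓘(ℝ, ℝ) (𝓡 n) 1 (φ ∘ γ) (Icc 0 1) := by
      refine (contMDiffOn_extChartAt (I := 𝓡 n) (n := 1) (x := x)).comp hγs.contMDiffOn fun t ht => ?_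
      have := (hball (hγball t ht)).1
      rwa [hφ, extChartAt_source] at this
    have hhs : ContDiffOn ℝ 1 h (Icc 0 1) :=
      S.contDiff.comp_contDiffOn (contMDiffOn_iff_contDiffOn.1 hφγ)
    have hder : ∀ t ∈ Icc (0 : ℝ) 1, ‖derivWithin h (Icc 0 1) t‖ₑ ≤
        ENNReal.ofReal δ * ‖mfderiv 𝓘(ℝ, ℝ) (𝓡 n) γ t 1‖ₑ := by
      intro t ht
      have hbt := hball (hγball t ht)
      have hsrct : γ t ∈ (chartAt (EuclideanSpace ℝ (Fin n)) x).source := by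
        have := hbt.1
        rwa [hφ, extChartAt_source] at this
      have hφd := mdifferentiableAt_extChartAt (I := 𝓡 n) hsrct
      have hγd : MDifferentiableAt 𝓘(ℝ, ℝ) (𝓡 n) γ t := hγs.mdifferentiable one_ne_zero t
      have hcomp : mfderiv 𝓘(ℝ, ℝ) (𝓡 n) (φ ∘ γ) t =
          (mfderiv (𝓡 n) (𝓡 n) φ (γ t)).comp (mfderiv 𝓘(ℝ, ℝ) (𝓡 n) γ t) :=
        mfderiv_comp t hφd hγd
      have hdd : HasDerivAt (φ ∘ γ) (mfderiv (𝓡 n) (𝓡 n) φ (γ t) (mfderiv 𝓘(ℝ, ℝ) (𝓡 n) γ t 1)) t := by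
        have h1 : DifferentiableAt ℝ (φ ∘ γ) t :=
          mdifferentiableAt_iff_differentiableAt.1 (hφd.comp t hγd)
        have h2 := h1.hasDerivAt
        rw [← fderiv_apply_one_eq_deriv, ← mfderiv_eq_fderiv, hcomp] at h2
        exact h2
      have hS' : HasDerivAt h (S (mfderiv (𝓡 n) (𝓡 n) φ (γ t) (mfderiv 𝓘(ℝ, ℝ) (𝓡 n) γ t 1))) t :=
        (S : EuclideanSpace ℝ (Fin n) →L[ℝ] EuclideanSpace ℝ (Fin n)).hasFDerivAt.comp_hasDerivAt t hdd
      rw [hS'.hasDerivWithinAt.derivWithin (uniqueDiffOn_Icc zero_lt_one t ht), ← ofReal_norm,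
        ← ofReal_norm, ← ENNReal.ofReal_mul (by linarith)]
      exact ENNReal.ofReal_le_ofReal (hbt.2 _)
    calc ENNReal.ofReal ‖S (φ y - u₀)‖ = ‖h 1 - h 0‖ₑ := by
          simp only [hh, hγ0, hγ1, φ.right_inv hu₀, map_sub, ofReal_norm]
      _ ≤ ∫⁻ t in Icc (0 : ℝ) 1, ‖derivWithin h (Icc 0 1) t‖ₑ :=
          enorm_sub_le_lintegral_derivWithin_Icc_of_contDiffOn_Icc hhs zero_le_one
      _ ≤ ∫⁻ t in Icc (0 : ℝ) 1, ENNReal.ofReal δ * ‖mfderiv 𝓘(ℝ, ℝ) (𝓡 n) γ t 1‖ₑ :=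
          setLIntegral_mono' measurableSet_Icc hder
      _ = ENNReal.ofReal δ * Manifold.pathELength (𝓡 n) γ 0 1 := by
          rw [lintegral_const_mul' _ _ ENNReal.ofReal_ne_top,
            Manifold.pathELength_eq_lintegral_mfderiv_Icc]
      _ ≤ ENNReal.ofReal δ * c := by gcongr
  have hne : (𝓝[>] (edist (φ.symm u₀) y)).NeBot := nhdsGT_neBot_of_exists_gt ⟨ρ, hy⟩
  have hlim : Tendsto (fun c => ENNReal.ofReal δ * c) (𝓝[>] (edist (φ.symm u₀) y))
      (𝓝 (ENNReal.ofReal δ * edist (φ.symm u₀) y)) :=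
    (ENNReal.Tendsto.const_mul tendsto_id (Or.inr ENNReal.ofReal_ne_top)).mono_left
      nhdsWithin_le_nhds
  refine ge_of_tendsto hlim ?_
  filter_upwards [Ioo_mem_nhdsGT hy] with c hc using hstep c hc.1 hc.2

end BallComparison

/-! ### The volume derivative bounded by the Jacobian determinant. -/

section JacobianBound

variable {n : ℕ}

theorem ContinuousLinearEquiv.exists_forall_norm_sub_lt {P : EuclideanSpace ℝ (Fin n) → Prop}
    {c : EuclideanSpace ℝ (Fin n)} (h : ∀ᶠ u in 𝓝 c, P u)
    (G : EuclideanSpace ℝ (Fin n) ≃L[ℝ] EuclideanSpace ℝ (Fin n)) :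
    ∃ ρ > 0, ∀ u, ‖G (u - c)‖ < ρ → P u := by
  have hg : Tendsto (fun z => c + G.symm z) (𝓝 0) (𝓝 c) := by
    have : Continuous fun z => c + G.symm z := by fun_prop
    simpa using this.tendsto 0
  obtain ⟨ρ, hρ, H⟩ := Metric.eventually_nhds_iff.1 (hg.eventually h)
  refine ⟨ρ, hρ, fun u hu => ?_⟩
  have := H (y := G (u - c)) (by simpa using hu)
  simpa using this

theorem ContinuousLinearEquiv.volume_norm_sub_lt
    (G : EuclideanSpace ℝ (Fin n) ≃L[ℝ] EuclideanSpace ℝ (Fin n))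
    (c : EuclideanSpace ℝ (Fin n)) {s : ℝ} (hs : 0 < s) :
    volume {u | ‖G (u - c)‖ < s} = ENNReal.ofReal |(G : EuclideanSpace ℝ (Fin n) →L[ℝ] _).det⁻¹| *
      (ENNReal.ofReal (s ^ n) * volume (Metric.ball (0 : EuclideanSpace ℝ (Fin n)) 1)) := by
  have h1 : {u | ‖G (u - c)‖ < s} = (fun u => u - c) ⁻¹' (G ⁻¹' Metric.ball 0 s) := by
    ext u
    simp
  have h2 : volume ((fun u => u - c) ⁻¹' (G ⁻¹' Metric.ball 0 s)) =
      volume (G ⁻¹' Metric.ball 0 s) := by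
    simpa only [sub_eq_add_neg] using measure_preimage_add_right volume (-c) _
  rw [h1, h2]
  have hdet : LinearMap.det (G.toLinearEquiv : EuclideanSpace ℝ (Fin n) →ₗ[ℝ] _) ≠ 0 :=
    (LinearEquiv.isUnit_det' G.toLinearEquiv).ne_zero
  have := Measure.addHaar_preimage_linearMap volume hdet (Metric.ball 0 s)
  rw [Measure.addHaar_ball_of_pos volume 0 hs, finrank_euclideanSpace_fin] at this
  exact this

variable {M : Type*} [EMetricSpace M] [SecondCountableTopology M]
    [ChartedSpace (EuclideanSpace ℝ (Fin n)) M] [IsManifold (𝓡 n) ∞ M]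
    [RiemannianBundle (fun x : M => TangentSpace (𝓡 n) x)]
    [IsContMDiffRiemannianBundle (𝓡 n) ∞ (EuclideanSpace ℝ (Fin n))
      (fun x : M => TangentSpace (𝓡 n) x)]
    [IsRiemannianManifold (𝓡 n) M] [MeasurableSpace M] [BorelSpace M]
    {M' : Type*} [EMetricSpace M'] [SecondCountableTopology M']
    [ChartedSpace (EuclideanSpace ℝ (Fin n)) M'] [IsManifold (𝓡 n) ∞ M']
    [RiemannianBundle (fun x : M' => TangentSpace (𝓡 n) x)]
    [IsContMDiffRiemannianBundle (𝓡 n) ∞ (EuclideanSpace ℝ (Fin n))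
      (fun x : M' => TangentSpace (𝓡 n) x)]
    [MeasurableSpace M'] [BorelSpace M']

omit [IsContMDiffRiemannianBundle (𝓡 n) ∞ (EuclideanSpace ℝ (Fin n))
      (fun x : M => TangentSpace (𝓡 n) x)] [IsRiemannianManifold (𝓡 n) M] in
/-- Lower bound for the volume of a set containing an ellipsoid in a chart. -/
theorem mul_volume_le_mul_riemannianVolume (x : M) {B : Set M} (hB : MeasurableSet B)
    {P : Set (EuclideanSpace ℝ (Fin n))} (hP : P ⊆ (extChartAt (𝓡 n) x).target)
    (hPB : ∀ u ∈ P, (extChartAt (𝓡 n) x).symm u ∈ B) {a δ : ℝ≥0∞}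
    (ha : ∀ u ∈ P, a ≤ δ * chartDensity x u) (hPm : MeasurableSet P) (hδ : δ ≠ ⊤) :
    a * volume P ≤ δ * riemannianVolume (n := n) M B := by
  have hm := hB.inter (isOpen_extChartAt_source (I := 𝓡 n) x).measurableSet
  calc a * volume P = ∫⁻ _ in P, a := by simp
    _ ≤ ∫⁻ u in P, δ * chartDensity x u := setLIntegral_mono' hPm ha
    _ = δ * ∫⁻ u in P, chartDensity x u := lintegral_const_mul' _ _ hδ
    _ ≤ δ * riemannianVolume (n := n) M (B ∩ (extChartAt (𝓡 n) x).source) := by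
        rw [riemannianVolume_eq_setLIntegral x hm inter_subset_right]
        gcongr
        exact fun u hu => ⟨hP hu, hPB u hu, (extChartAt (𝓡 n) x).map_target (hP hu)⟩
    _ ≤ δ * riemannianVolume (n := n) M B := by gcongr; exact inter_subset_left

omit [IsContMDiffRiemannianBundle (𝓡 n) ∞ (EuclideanSpace ℝ (Fin n))
      (fun x : M => TangentSpace (𝓡 n) x)] [IsRiemannianManifold (𝓡 n) M] in
/-- Upper bound for the volume of a set contained in an ellipsoid in a chart. -/
theorem riemannianVolume_le_mul_volume (y : M) {R : Set M}
    {Q : Set (EuclideanSpace ℝ (Fin n))} (hQ : IsOpen Q)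
    (hR : R ⊆ (extChartAt (𝓡 n) y).source) (hRQ : ∀ z ∈ R, extChartAt (𝓡 n) y z ∈ Q) {b : ℝ≥0∞}
    (hb : ∀ z ∈ Q, chartDensity y z ≤ b) :
    riemannianVolume (n := n) M R ≤ b * volume Q := by
  have hopen : IsOpen ((extChartAt (𝓡 n) y).source ∩ extChartAt (𝓡 n) y ⁻¹' Q) :=
    (continuousOn_extChartAt y).isOpen_inter_preimage (isOpen_extChartAt_source y) hQ
  calc riemannianVolume (n := n) M R
      ≤ riemannianVolume (n := n) M ((extChartAt (𝓡 n) y).source ∩ extChartAt (𝓡 n) y ⁻¹' Q) :=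
        measure_mono fun z hz => ⟨hR hz, hRQ z hz⟩
    _ = ∫⁻ z in (extChartAt (𝓡 n) y).target ∩ (extChartAt (𝓡 n) y).symm ⁻¹'
          ((extChartAt (𝓡 n) y).source ∩ extChartAt (𝓡 n) y ⁻¹' Q), chartDensity y z :=
        riemannianVolume_eq_setLIntegral y hopen.measurableSet inter_subset_left
    _ ≤ ∫⁻ z in Q, chartDensity y z := by
        refine lintegral_mono_set ?_
        rintro z ⟨hz, -, hz2⟩
        rwa [mem_preimage, (extChartAt (𝓡 n) y).right_inv hz] at hz2
    _ ≤ ∫⁻ _ in Q, b := setLIntegral_mono' hQ.measurableSet hb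
    _ = b * volume Q := by simp

/-- The ball of radius `s` contains the ellipsoid `‖S (u - u₀)‖ < s / δ`, and its image lies in `‖G
(z - z₀)‖ < δ² s` with `G = S A⁻¹`. Their Lebesgue volumes have ratio `δ^(3n) |det A|`; each of the
two densities, nearly constant, costs one more factor `δ`. -/
theorem volumeJacobian_mul_chartDensity_le_aux (f : M → M') (x : M) (y : M')
    {u₀ : EuclideanSpace ℝ (Fin n)} (hu₀ : u₀ ∈ (extChartAt (𝓡 n) x).target)
    (hfu₀ : f ((extChartAt (𝓡 n) x).symm u₀) ∈ (extChartAt (𝓡 n) y).source)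
    (hf : ContinuousAt f ((extChartAt (𝓡 n) x).symm u₀))
    {A : EuclideanSpace ℝ (Fin n) ≃L[ℝ] EuclideanSpace ℝ (Fin n)}
    (hA : HasFDerivAt (extChartAt (𝓡 n) y ∘ f ∘ (extChartAt (𝓡 n) x).symm)
      (A : EuclideanSpace ℝ (Fin n) →L[ℝ] _) u₀) {δ : ℝ} (hδ : 1 < δ) :
    volumeJacobian (riemannianVolume (n := n) M) (riemannianVolume (n := n) M') f
        ((extChartAt (𝓡 n) x).symm u₀) * chartDensity x u₀ ≤
      ENNReal.ofReal (δ ^ (3 * n + 2)) *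
        (ENNReal.ofReal |(A : EuclideanSpace ℝ (Fin n) →L[ℝ] _).det| *
          chartDensity y (extChartAt (𝓡 n) y (f ((extChartAt (𝓡 n) x).symm u₀)))) := by
  set φ := extChartAt (𝓡 n) x with hφ
  set ψ := extChartAt (𝓡 n) y with hψ
  set F := ψ ∘ f ∘ φ.symm with hF
  set x₁ := φ.symm u₀ with hx₁
  set z₀ := ψ (f x₁) with hz₀
  set a := chartDensity x u₀ with ha
  set b := chartDensity y z₀ with hb
  have hδ0 : 0 < δ := by linarith
  have ha0 : a ≠ 0 := chartDensity_ne_zero x hu₀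
  have hatop : a ≠ ⊤ := chartDensity_ne_top x u₀
  have hb0 : b ≠ 0 := chartDensity_ne_zero y (ψ.map_source hfu₀)
  have hbtop : b ≠ ⊤ := chartDensity_ne_top y z₀
  obtain ⟨S, hS⟩ := exists_linearEquiv_inner_eq (chartDeriv n x u₀).toLinearMap
    (injective_chartDeriv x hu₀)
  have h1δ : (1 : ℝ≥0∞) < ENNReal.ofReal δ := by
    rw [← ENNReal.ofReal_one]
    exact (ENNReal.ofReal_lt_ofReal_iff hδ0).2 hδ
  -- the chart of `M` near `u₀`
  have hN1 : ∀ᶠ u in 𝓝 u₀, u ∈ φ.target ∧ a ≤ ENNReal.ofReal δ * chartDensity x u ∧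
      edist x₁ (φ.symm u) ≤ ENNReal.ofReal (δ * ‖S (u - u₀)‖) := by
    have hcont := (continuousOn_chartDensity x).continuousAt
      ((isOpen_extChartAt_target x).mem_nhds hu₀)
    have hlt : a / ENNReal.ofReal δ < a := by
      refine ENNReal.div_lt_of_lt_mul ?_
      calc a = a * 1 := (mul_one a).symm
        _ < a * ENNReal.ofReal δ := ENNReal.mul_lt_mul_right ha0 hatop h1δ
    filter_upwards [(isOpen_extChartAt_target x).mem_nhds hu₀, hcont.eventually (lt_mem_nhds hlt),
      eventually_edist_extChartAt_symm_le x hu₀ hS hδ] with u h1 h2 h3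
    refine ⟨h1, ?_, h3⟩
    rw [mul_comm]
    exact (ENNReal.div_le_iff (by simpa using hδ0) ENNReal.ofReal_ne_top).1 h2.le
  obtain ⟨ρ₁, hρ₁, H1⟩ := S.exists_forall_norm_sub_lt hN1
  -- the chart of `M'` near `z₀`
  have hN2 : ∀ᶠ z in 𝓝 z₀, chartDensity y z ≤ ENNReal.ofReal δ * b := by
    have hcont := (continuousOn_chartDensity y).continuousAt
      ((isOpen_extChartAt_target y).mem_nhds (ψ.map_source hfu₀))
    have hlt : b < ENNReal.ofReal δ * b := by
      calc b = b * 1 := (mul_one b).symm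
        _ < b * ENNReal.ofReal δ := ENNReal.mul_lt_mul_right hb0 hbtop h1δ
        _ = _ := mul_comm _ _
    filter_upwards [hcont.eventually (gt_mem_nhds hlt)] with z hz using hz.le
  -- With this choice `G ∘ A = S`, so the ellipsoid in the target is the linear image of the one in
  -- the source and the metric of the target enters only through its density.
  set G : EuclideanSpace ℝ (Fin n) ≃L[ℝ] EuclideanSpace ℝ (Fin n) := A.symm.trans S with hG
  obtain ⟨ρ₂, hρ₂, H2⟩ := G.exists_forall_norm_sub_lt hN2
  -- points of `M` near `x₁`
  have hsrc : x₁ ∈ φ.source := φ.map_target hu₀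
  have hφx₁ : φ x₁ = u₀ := φ.right_inv hu₀
  have hcontφ : Tendsto φ (𝓝 x₁) (𝓝 u₀) := by
    rw [← hφx₁]
    exact (continuousOn_extChartAt x).continuousAt ((isOpen_extChartAt_source x).mem_nhds hsrc)
  have hlin : ∀ᶠ u in 𝓝 u₀, ‖G (F u - z₀)‖ ≤ δ * ‖S (u - u₀)‖ := by
    have hkey : HasFDerivAt (fun u => G (F u - z₀)) (S : EuclideanSpace ℝ (Fin n) →L[ℝ] _) u₀ := by
      have h1 := (G : EuclideanSpace ℝ (Fin n) →L[ℝ] EuclideanSpace ℝ (Fin n)).hasFDerivAt.comp u₀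
        (hA.sub_const z₀)
      refine h1.congr_fderiv ?_
      ext v
      simp [hG]
    have h2 := hkey.isLittleO
    have h3 : (fun u => u - u₀) =O[𝓝 u₀] fun u => S (u - u₀) := by
      refine Asymptotics.IsBigO.of_bound
        ‖(S.symm : EuclideanSpace ℝ (Fin n) →L[ℝ] EuclideanSpace ℝ (Fin n))‖
        (Eventually.of_forall fun u => ?_)
      simpa using (S.symm : EuclideanSpace ℝ (Fin n) →L[ℝ] EuclideanSpace ℝ (Fin n)).le_opNorm
        (S (u - u₀))
    have h4 := (h2.trans_isBigO h3).bound (sub_pos.2 hδ)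
    filter_upwards [h4] with u hu
    have h5 : G (F u₀ - z₀) = 0 := by
      simp [hF, hz₀, hx₁]
    have h6 : G (F u - z₀) = (G (F u - z₀) - G (F u₀ - z₀) - S (u - u₀)) + S (u - u₀) := by
      rw [h5]
      abel
    rw [h6]
    refine (norm_add_le _ _).trans ?_
    have h7 : ‖G (F u - z₀) - G (F u₀ - z₀) - S (u - u₀)‖ ≤ (δ - 1) * ‖S (u - u₀)‖ := hu
    linarith
  have hN3 : ∀ᶠ z in 𝓝 x₁, z ∈ φ.source ∧ f z ∈ ψ.source ∧
      ENNReal.ofReal ‖S (φ z - u₀)‖ ≤ ENNReal.ofReal δ * edist x₁ z ∧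
      ‖G (F (φ z) - z₀)‖ ≤ δ * ‖S (φ z - u₀)‖ := by
    filter_upwards [(isOpen_extChartAt_source x).mem_nhds hsrc,
      hf.preimage_mem_nhds ((isOpen_extChartAt_source y).mem_nhds hfu₀),
      eventually_norm_extChartAt_sub_le x hu₀ hS hδ, hcontφ.eventually hlin] with z h1 h2 h3 h4
    exact ⟨h1, h2, h3, h4⟩
  obtain ⟨ρ₃, hρ₃, H3⟩ := EMetric.mem_nhds_iff.1 hN3
  -- the estimate for small balls
  have hball : ∀ᶠ r : ℝ≥0∞ in 𝓝[>] 0, riemannianVolume (n := n) M' (f '' Metric.eball x₁ r) /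
      riemannianVolume (n := n) M (Metric.eball x₁ r) ≤
      ENNReal.ofReal (δ ^ (3 * n + 2)) *
        (ENNReal.ofReal |(A : EuclideanSpace ℝ (Fin n) →L[ℝ] _).det| * b) / a := by
    -- The three bounds put `s / δ` below `ρ₁`, `δ² s` below `ρ₂` and the ball inside the one of
    -- radius `ρ₃`.
    have hmin : 0 < min (ENNReal.ofReal (min (ρ₁ * δ) (ρ₂ / δ ^ 2))) ρ₃ :=
      lt_min (ENNReal.ofReal_pos.2 (lt_min (by positivity) (by positivity))) hρ₃
    filter_upwards [Ioo_mem_nhdsGT hmin] with r hr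
    obtain ⟨hr0, hr⟩ := hr
    obtain ⟨hr1, hr3⟩ := lt_min_iff.1 hr
    lift r to NNReal using ne_top_of_lt hr3
    obtain ⟨s, hs⟩ : ∃ s : ℝ, s = r := ⟨_, rfl⟩
    have hrs : (r : ℝ≥0∞) = ENNReal.ofReal s := by simp [hs]
    rw [hrs] at hr0 hr1 hr3 ⊢
    have hs0 : 0 < s := ENNReal.ofReal_pos.1 hr0
    have hs1 : s < min (ρ₁ * δ) (ρ₂ / δ ^ 2) := (ENNReal.ofReal_lt_ofReal_iff_of_nonneg hs0.le).1 hr1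
    obtain ⟨hs1, hs2⟩ := lt_min_iff.1 hs1
    have hsδ : s / δ < ρ₁ := by rwa [div_lt_iff₀ hδ0]
    have hsδ2 : δ ^ 2 * s < ρ₂ := by rwa [lt_div_iff₀ (by positivity), mul_comm] at hs2
    have hlow := mul_volume_le_mul_riemannianVolume x
      (B := Metric.eball x₁ (ENNReal.ofReal s)) Metric.isOpen_eball.measurableSet
      (P := {u | ‖S (u - u₀)‖ < s / δ}) (a := a) (δ := ENNReal.ofReal δ)
      (fun u hu => (H1 u (hu.trans hsδ)).1)
      (fun u hu => by
        rw [Metric.mem_eball, edist_comm]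
        refine (H1 u (hu.trans hsδ)).2.2.trans_lt ((ENNReal.ofReal_lt_ofReal_iff hs0).2 ?_)
        have := mul_lt_mul_of_pos_left (show ‖S (u - u₀)‖ < s / δ from hu) hδ0
        rwa [mul_div_cancel₀ _ hδ0.ne'] at this)
      (fun u hu => (H1 u (hu.trans hsδ)).2.1)
      (isOpen_lt (by fun_prop) continuous_const).measurableSet ENNReal.ofReal_ne_top
    have hup := riemannianVolume_le_mul_volume y
      (R := f '' Metric.eball x₁ (ENNReal.ofReal s)) (Q := {z | ‖G (z - z₀)‖ < δ ^ 2 * s})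
      (isOpen_lt (by fun_prop) continuous_const)
      (by
        rintro _ ⟨z, hz, rfl⟩
        exact (H3 (Metric.eball_subset_eball hr3.le hz)).2.1)
      (by
        rintro _ ⟨z, hz, rfl⟩
        obtain ⟨h1, h2, h3, h4⟩ := H3 (Metric.eball_subset_eball hr3.le hz)
        rw [Metric.mem_eball, edist_comm] at hz
        have h5 : ‖S (φ z - u₀)‖ < δ * s := by
          rw [← ENNReal.ofReal_lt_ofReal_iff (by positivity), ENNReal.ofReal_mul hδ0.le]
          refine h3.trans_lt (ENNReal.mul_lt_mul_right (by simpa using hδ0)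
            ENNReal.ofReal_ne_top hz)
        have h6 : F (φ z) = ψ (f z) := by simp [hF, φ.left_inv h1]
        rw [h6] at h4
        change ‖G (ψ (f z) - z₀)‖ < δ ^ 2 * s
        nlinarith)
      (b := ENNReal.ofReal δ * b) (fun z hz => H2 z (lt_trans hz hsδ2))
    have hvol : volume {z | ‖G (z - z₀)‖ < δ ^ 2 * s} = ENNReal.ofReal (δ ^ (3 * n)) *
        (ENNReal.ofReal |(A : EuclideanSpace ℝ (Fin n) →L[ℝ] _).det| *
          volume {u | ‖S (u - u₀)‖ < s / δ}) := by
      rw [G.volume_norm_sub_lt z₀ (by positivity), S.volume_norm_sub_lt u₀ (by positivity)]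
      have hdet : (G : EuclideanSpace ℝ (Fin n) →L[ℝ] EuclideanSpace ℝ (Fin n)).det =
          (S : EuclideanSpace ℝ (Fin n) →L[ℝ] EuclideanSpace ℝ (Fin n)).det *
          ((A : EuclideanSpace ℝ (Fin n) →L[ℝ] EuclideanSpace ℝ (Fin n)).det)⁻¹ := by
        have h1 : (G : EuclideanSpace ℝ (Fin n) →L[ℝ] EuclideanSpace ℝ (Fin n)).det =
          (S : EuclideanSpace ℝ (Fin n) →L[ℝ] EuclideanSpace ℝ (Fin n)).det *
          (A.symm : EuclideanSpace ℝ (Fin n) →L[ℝ] EuclideanSpace ℝ (Fin n)).det :=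
          LinearMap.det_comp (S.toLinearEquiv : EuclideanSpace ℝ (Fin n) →ₗ[ℝ] _)
            (A.symm.toLinearEquiv : EuclideanSpace ℝ (Fin n) →ₗ[ℝ] _)
        rw [h1, A.det_coe_symm]
      rw [hdet, mul_inv, inv_inv, abs_mul, ENNReal.ofReal_mul (abs_nonneg _)]
      have hpow : ENNReal.ofReal ((δ ^ 2 * s) ^ n) =
          ENNReal.ofReal (δ ^ (3 * n)) * ENNReal.ofReal ((s / δ) ^ n) := by
        rw [← ENNReal.ofReal_mul (by positivity), pow_mul, ← mul_pow]
        congr 2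
        field_simp
      rw [hpow]
      ring
    rw [hvol] at hup
    have hfin : a * riemannianVolume (n := n) M' (f '' Metric.eball x₁ (ENNReal.ofReal s)) ≤
        ENNReal.ofReal (δ ^ (3 * n + 2)) *
        (ENNReal.ofReal |(A : EuclideanSpace ℝ (Fin n) →L[ℝ] _).det| * b) *
        riemannianVolume (n := n) M (Metric.eball x₁ (ENNReal.ofReal s)) := by
      have hpow : ENNReal.ofReal (δ ^ (3 * n + 2)) =
          ENNReal.ofReal (δ ^ (3 * n)) * ENNReal.ofReal δ * ENNReal.ofReal δ := by
        rw [← ENNReal.ofReal_mul (by positivity), ← ENNReal.ofReal_mul (by positivity)]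
        congr 1
      calc a * riemannianVolume (n := n) M' (f '' Metric.eball x₁ (ENNReal.ofReal s))
          ≤ a * (ENNReal.ofReal δ * b * (ENNReal.ofReal (δ ^ (3 * n)) *
            (ENNReal.ofReal |(A : EuclideanSpace ℝ (Fin n) →L[ℝ] _).det| *
              volume {u | ‖S (u - u₀)‖ < s / δ}))) := by gcongr
        _ = ENNReal.ofReal δ * b * ENNReal.ofReal (δ ^ (3 * n)) *
            ENNReal.ofReal |(A : EuclideanSpace ℝ (Fin n) →L[ℝ] _).det| *
              (a * volume {u | ‖S (u - u₀)‖ < s / δ}) := by ring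
        _ ≤ ENNReal.ofReal δ * b * ENNReal.ofReal (δ ^ (3 * n)) *
            ENNReal.ofReal |(A : EuclideanSpace ℝ (Fin n) →L[ℝ] _).det| *
              (ENNReal.ofReal δ *
                riemannianVolume (n := n) M (Metric.eball x₁ (ENNReal.ofReal s))) := by gcongr
        _ = _ := by
          rw [hpow]
          ring
    refine ENNReal.div_le_of_le_mul ?_
    rw [ENNReal.div_eq_inv_mul, mul_assoc, ← ENNReal.div_eq_inv_mul,
      ENNReal.le_div_iff_mul_le (Or.inl ha0) (Or.inl hatop), mul_comm]
    exact hfin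
  have hJ : volumeJacobian (riemannianVolume (n := n) M) (riemannianVolume (n := n) M') f x₁ ≤ _ :=
    limsup_le_of_le (by isBoundedDefault) hball
  exact (ENNReal.le_div_iff_mul_le (Or.inl ha0) (Or.inl hatop)).1 hJ

/-- The volume derivative is at most the absolute value of the Jacobian determinant, at a point
where the latter does not vanish. -/
theorem volumeJacobian_mul_chartDensity_le (f : M → M') (x : M) (y : M')
    {u₀ : EuclideanSpace ℝ (Fin n)} (hu₀ : u₀ ∈ (extChartAt (𝓡 n) x).target)
    (hfu₀ : f ((extChartAt (𝓡 n) x).symm u₀) ∈ (extChartAt (𝓡 n) y).source)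
    (hf : ContinuousAt f ((extChartAt (𝓡 n) x).symm u₀))
    {A : EuclideanSpace ℝ (Fin n) →L[ℝ] EuclideanSpace ℝ (Fin n)}
    (hA : HasFDerivAt (extChartAt (𝓡 n) y ∘ f ∘ (extChartAt (𝓡 n) x).symm) A u₀)
    (hdet : A.det ≠ 0) :
    volumeJacobian (riemannianVolume (n := n) M) (riemannianVolume (n := n) M') f
        ((extChartAt (𝓡 n) x).symm u₀) * chartDensity x u₀ ≤
      ENNReal.ofReal |A.det| *
          chartDensity y (extChartAt (𝓡 n) y (f ((extChartAt (𝓡 n) x).symm u₀))) := by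
  set e := A.toContinuousLinearEquivOfDetNeZero hdet with he
  have heA : (e : EuclideanSpace ℝ (Fin n) →L[ℝ] EuclideanSpace ℝ (Fin n)) = A :=
    A.coe_toContinuousLinearEquivOfDetNeZero hdet
  rw [← heA] at hA
  have key := fun δ (hδ : 1 < δ) =>
    volumeJacobian_mul_chartDensity_le_aux f x y hu₀ hfu₀ hf hA (δ := δ) hδ
  rw [heA] at key
  set C := ENNReal.ofReal |A.det| *
          chartDensity y (extChartAt (𝓡 n) y (f ((extChartAt (𝓡 n) x).symm u₀))) with hC
  have hCtop : C ≠ ⊤ := ENNReal.mul_ne_top ENNReal.ofReal_ne_top (chartDensity_ne_top _ _)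
  have hlim : Tendsto (fun δ : ℝ => ENNReal.ofReal (δ ^ (3 * n + 2)) * C) (𝓝[>] 1) (𝓝 C) := by
    have h1 : Tendsto (fun δ : ℝ => ENNReal.ofReal (δ ^ (3 * n + 2))) (𝓝[>] 1) (𝓝 1) := by
      have hc : Continuous fun δ : ℝ => ENNReal.ofReal (δ ^ (3 * n + 2)) :=
        ENNReal.continuous_ofReal.comp (continuous_pow _)
      have := hc.tendsto 1
      simp only [one_pow, ENNReal.ofReal_one] at this
      exact this.mono_left nhdsWithin_le_nhds
    have := ENNReal.Tendsto.mul_const h1 (Or.inr hCtop)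
    rwa [one_mul] at this
  refine ge_of_tendsto hlim ?_
  filter_upwards [self_mem_nhdsWithin] with δ hδ using key δ hδ

end JacobianBound

/-! ### Multiplicity of a map on disjoint pieces. -/

section Multiplicity

theorem indicator_image_le_preimageCount {X Y : Type*} (f : X → Y) (A : Set X) (y : Y) :
    (f '' A).indicator (fun _ => (1 : ℝ≥0∞)) y ≤ preimageCount f A y := by
  by_cases hy : y ∈ f '' A
  · rw [indicator_of_mem hy, preimageCount, ← ENat.toENNReal_one]
    obtain ⟨x, hx, hxy⟩ := hy
    exact ENat.toENNReal_mono (one_le_encard_iff_nonempty.2 ⟨x, hx, hxy⟩)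
  · simp [hy]

theorem tsum_preimageCount_le {X Y ι : Type*} (f : X → Y) {A : Set X} {P : ι → Set X}
    (hP : Pairwise (Function.onFun Disjoint P)) (hPA : ∀ i, P i ⊆ A) (y : Y) :
    ∑' i, preimageCount f (P i) y ≤ preimageCount f A y := by
  classical
  rw [ENNReal.tsum_eq_iSup_sum]
  refine iSup_le fun s => ?_
  have key : ∑ i ∈ s, preimageCount f (P i) y = preimageCount f (⋃ i ∈ s, P i) y := by
    induction s using Finset.induction with
    | empty => simp [preimageCount]
    | insert a s ha ih =>
      rw [Finset.sum_insert ha, ih, preimageCount, preimageCount, preimageCount,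
        ← ENat.toENNReal_add, ← encard_union_eq]
      · congr 2
        ext x
        simp only [Finset.mem_insert, iUnion_iUnion_eq_or_left, mem_union, mem_ofPred_eq]
        tauto
      · rw [disjoint_left]
        rintro x ⟨hx, -⟩ ⟨hx', -⟩
        simp only [mem_iUnion] at hx'
        obtain ⟨i, hi, hxi⟩ := hx'
        exact disjoint_left.1 (hP (ne_of_mem_of_not_mem hi ha)) hxi hx
  rw [key]
  refine ENat.toENNReal_mono (encard_le_encard ?_)
  rintro x ⟨hx, hxy⟩
  simp only [mem_iUnion] at hx
  obtain ⟨i, -, hxi⟩ := hx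
  exact ⟨hPA i hxi, hxy⟩

end Multiplicity

/-- A differentiable map with nonvanishing Jacobian determinant is injective on each piece of some
countable measurable partition. -/
theorem exists_partition_injOn_of_det_fderivWithin_ne_zero {E : Type*} [NormedAddCommGroup E]
    [NormedSpace ℝ E] [FiniteDimensional ℝ E] [MeasurableSpace E] [BorelSpace E]
    {F : E → E} {F' : E → E →L[ℝ] E} {S : Set E} (hS : MeasurableSet S)
    (hF : ∀ x ∈ S, HasFDerivWithinAt F (F' x) S x) (hdet : ∀ x ∈ S, (F' x).det ≠ 0) :
    ∃ t : ℕ → Set E, (∀ k, MeasurableSet (t k)) ∧ Pairwise (Function.onFun Disjoint t) ∧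
      ⋃ k, t k = S ∧ ∀ k, InjOn F (t k) := by
  classical
  have : SecondCountableTopology E := secondCountable_of_proper
  rcases S.eq_empty_or_nonempty with rfl | hne
  · exact ⟨fun _ => ∅, by simp, fun _ _ _ => by simp [Function.onFun], by simp, by simp⟩
  -- In the zero space `‖A⁻¹‖ = 0`, so the radius below would vanish; there every map is injective
  -- anyway.
  rcases subsingleton_or_nontrivial E with hE | hE
  · refine ⟨fun k => if k = 0 then S else ∅, fun k => ?_, fun i j hij => ?_, ?_, fun k => ?_⟩
    · dsimp only
      split_ifs
      exacts [hS, MeasurableSet.empty]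
    · simp only [Function.onFun]
      split_ifs with h1 h2
      · exact absurd (h1.trans h2.symm) hij
      all_goals simp
    · ext x
      simp
    · exact fun a _ b _ _ => Subsingleton.elim _ _
  -- A perturbation of an invertible `A` with Lipschitz constant below `‖A⁻¹‖⁻¹` remains injective;
  -- half of that bound keeps the inequality strict.
  let r : (E →L[ℝ] E) → NNReal := fun A =>
    if h : A.det ≠ 0 then ‖((A.toContinuousLinearEquivOfDetNeZero h).symm : E →L[ℝ] E)‖₊⁻¹ / 2
    else 1
  have rpos : ∀ A, r A ≠ 0 := by
    intro A
    by_cases h : A.det ≠ 0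
    · have := (A.toContinuousLinearEquivOfDetNeZero h).nnnorm_symm_pos
      simp only [r, dif_pos h]
      positivity
    · simp only [r, dif_neg h]
      exact one_ne_zero
  obtain ⟨t, A, htd, htm, hSt, happ, hA⟩ :=
    exists_partition_approximatesLinearOn_of_hasFDerivWithinAt F S F' hF r rpos
  refine ⟨fun k => S ∩ t k, fun k => hS.inter (htm k),
    fun i j hij => (htd hij).mono inter_subset_right inter_subset_right, ?_, fun k => ?_⟩
  · rw [← inter_iUnion, inter_eq_left.2 hSt]
  -- Each approximating map is the derivative at some point of `S`, hence invertible.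
  · obtain ⟨y, hy, hAy⟩ := hA hne k
    have h : (A k).det ≠ 0 := hAy ▸ hdet y hy
    have h1 : ApproximatesLinearOn F
        ((A k).toContinuousLinearEquivOfDetNeZero h : E →L[ℝ] E) (S ∩ t k) (r (A k)) := by
      simpa using happ k
    refine h1.injOn (Or.inr ?_)
    simp only [r, dif_pos h]
    have := ((A k).toContinuousLinearEquivOfDetNeZero h).nnnorm_symm_pos
    exact NNReal.half_lt_self (by positivity)

/-! ### The area formula with multiplicity. -/

section Area

variable {n : ℕ} {M : Type*} [EMetricSpace M] [SecondCountableTopology M]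
    [ChartedSpace (EuclideanSpace ℝ (Fin n)) M] [IsManifold (𝓡 n) ∞ M]
    [RiemannianBundle (fun x : M => TangentSpace (𝓡 n) x)]
    [IsContMDiffRiemannianBundle (𝓡 n) ∞ (EuclideanSpace ℝ (Fin n))
      (fun x : M => TangentSpace (𝓡 n) x)]
    [MeasurableSpace M] [BorelSpace M]

/-- The area formula for a map from a coordinate space into a manifold, as an inequality for the
multiplicity of the map. -/
theorem exists_multiplicity_setLIntegral_eq {X : Type*} (f : X → M) (y : M)
    (k : EuclideanSpace ℝ (Fin n) → X) {S : Set (EuclideanSpace ℝ (Fin n))} {P : Set X}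
    (hS : MeasurableSet S) (hk : InjOn k S) (hkP : MapsTo k S P)
    (hfS : ∀ u ∈ S, f (k u) ∈ (extChartAt (𝓡 n) y).source)
    {F' : EuclideanSpace ℝ (Fin n) → EuclideanSpace ℝ (Fin n) →L[ℝ] EuclideanSpace ℝ (Fin n)}
    (hF : ∀ u ∈ S, HasFDerivAt (extChartAt (𝓡 n) y ∘ f ∘ k) (F' u) u)
    (hdet : ∀ u ∈ S, (F' u).det ≠ 0) :
    ∃ N : M → ℝ≥0∞, Measurable N ∧ (∀ z, N z ≤ preimageCount f P z) ∧
      ∀ h : M → ℝ≥0∞, Measurable h →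
        ∫⁻ u in S, ENNReal.ofReal |(F' u).det| *
            chartDensity y (extChartAt (𝓡 n) y (f (k u))) * h (f (k u)) =
          ∫⁻ z, h z * N z ∂(riemannianVolume (n := n) M) := by
  set ψ := extChartAt (𝓡 n) y with hψ
  set F := ψ ∘ f ∘ k with hFdef
  obtain ⟨t, htm, htd, htS, hti⟩ := exists_partition_injOn_of_det_fderivWithin_ne_zero hS
    (fun u hu => (hF u hu).hasFDerivWithinAt) hdet
  have htS' : ∀ j, t j ⊆ S := fun j => htS ▸ subset_iUnion t j
  have hFt : ∀ j, ∀ u ∈ t j, HasFDerivWithinAt F (F' u) (t j) u := fun j u hu =>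
    (hF u (htS' j hu)).hasFDerivWithinAt
  have hFm : ∀ j, MeasurableSet (F '' t j) := fun j =>
    measurable_image_of_fderivWithin (htm j) (hFt j) (hti j)
  have himage : ∀ j, f '' (k '' t j) = ψ.source ∩ ψ ⁻¹' (F '' t j) := by
    intro j
    ext z
    constructor
    · rintro ⟨_, ⟨u, hu, rfl⟩, rfl⟩
      exact ⟨hfS u (htS' j hu), u, hu, rfl⟩
    · rintro ⟨hz, u, hu, huz⟩
      exact ⟨k u, ⟨u, hu, rfl⟩, ψ.injOn (hfS u (htS' j hu)) hz huz⟩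
  have hRm : ∀ j, MeasurableSet (f '' (k '' t j)) := fun j => by
    rw [himage j]
    exact measurableSet_source_inter_preimage y (hFm j)
  have hRsrc : ∀ j, f '' (k '' t j) ⊆ ψ.source := fun j => himage j ▸ inter_subset_left
  have htarget : ∀ j, ψ.target ∩ ψ.symm ⁻¹' (f '' (k '' t j)) = F '' t j := by
    intro j
    ext w
    constructor
    · rintro ⟨hw, hw2⟩
      rw [himage j] at hw2
      simpa only [mem_preimage, ψ.right_inv hw] using hw2.2
    · rintro ⟨u, hu, rfl⟩
      refine ⟨ψ.map_source (hfS u (htS' j hu)), ?_⟩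
      rw [mem_preimage, show ψ.symm (F u) = f (k u) from ψ.left_inv (hfS u (htS' j hu))]
      exact ⟨k u, ⟨u, hu, rfl⟩, rfl⟩
  -- `N` counts the injective pieces whose image contains `z`: a measurable minorant of the
  -- multiplicity which the area formula produces exactly.
  refine ⟨fun z => ∑' j, (f '' (k '' t j)).indicator (fun _ => 1) z, ?_, fun z => ?_,
    fun h hh => ?_⟩
  · exact Measurable.tsum fun j => measurable_const.indicator (hRm j)
  · refine (ENNReal.tsum_le_tsum fun j => indicator_image_le_preimageCount f (k '' t j) z).trans
      (tsum_preimageCount_le f (fun i j hij => ?_) (fun j => ?_) z)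
    · exact (htd hij).image hk (htS' i) (htS' j)
    · rintro _ ⟨u, hu, rfl⟩
      exact hkP (htS' j hu)
  · have hind : ∀ j z, h z * (f '' (k '' t j)).indicator (fun _ => 1) z =
        (f '' (k '' t j)).indicator h z := by
      intro j z
      by_cases hz : z ∈ f '' (k '' t j) <;> simp [hz]
    calc ∫⁻ u in S, ENNReal.ofReal |(F' u).det| * chartDensity y (ψ (f (k u))) * h (f (k u))
        = ∑' j, ∫⁻ u in t j, ENNReal.ofReal |(F' u).det| * chartDensity y (ψ (f (k u))) *
            h (f (k u)) := by
          rw [← htS, lintegral_iUnion htm htd]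
      _ = ∑' j, ∫⁻ z in f '' (k '' t j), h z ∂(riemannianVolume (n := n) M) := by
          refine tsum_congr fun j => ?_
          rw [setLIntegral_riemannianVolume y (hRm j) (hRsrc j) hh.aemeasurable, htarget j,
            lintegral_image_eq_lintegral_abs_det_fderiv_mul volume (htm j) (hFt j) (hti j)]
          refine setLIntegral_congr_fun (htm j) fun u hu => ?_
          have : ψ.symm (F u) = f (k u) := ψ.left_inv (hfS u (htS' j hu))
          beta_reduce
          rw [← hψ, this, mul_assoc]
          rfl
      _ = ∑' j, ∫⁻ z, h z * (f '' (k '' t j)).indicator (fun _ => 1) z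
            ∂(riemannianVolume (n := n) M) := by
          refine tsum_congr fun j => ?_
          simp only [hind, lintegral_indicator (hRm j)]
      _ = ∫⁻ z, h z * ∑' j, (f '' (k '' t j)).indicator (fun _ => 1) z
            ∂(riemannianVolume (n := n) M) := by
          simp only [← ENNReal.tsum_mul_left]
          rw [lintegral_tsum]
          exact fun j => (hh.mul (measurable_const.indicator (hRm j))).aemeasurable

end Area

/-! ### The dilatation inequality and its integrated form. -/

section Dilatation

variable {n : ℕ} {M : Type*} [EMetricSpace M] [SecondCountableTopology M]
    [ChartedSpace (EuclideanSpace ℝ (Fin n)) M] [IsManifold (𝓡 n) ∞ M]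
    [RiemannianBundle (fun x : M => TangentSpace (𝓡 n) x)]
    [IsContMDiffRiemannianBundle (𝓡 n) ∞ (EuclideanSpace ℝ (Fin n))
      (fun x : M => TangentSpace (𝓡 n) x)]
    [MeasurableSpace M] [BorelSpace M]

/-- Transfer of an almost everywhere property to a chart. -/
theorem ae_target_inter_preimage (x : M) {D : Set M} (hD : MeasurableSet D) {P : M → Prop}
    (h : ∀ᵐ z ∂(riemannianVolume (n := n) M).restrict D, P z) :
    ∀ᵐ u ∂volume.restrict ((extChartAt (𝓡 n) x).target ∩ (extChartAt (𝓡 n) x).symm ⁻¹' D),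
      P ((extChartAt (𝓡 n) x).symm u) := by
  rw [ae_restrict_iff' hD, ae_iff] at h
  rw [ae_restrict_iff' (measurableSet_target_inter_preimage (n := n) x hD), ae_iff]
  refine measure_mono_null ?_ (volume_target_inter_preimage_eq_zero x inter_subset_right
    (measure_mono_null inter_subset_left h :
      riemannianVolume (n := n) M (_ ∩ (extChartAt (𝓡 n) x).source) = 0))
  intro u hu
  simp only [mem_ofPred_eq, Classical.not_imp] at hu
  exact ⟨hu.1.1, fun h' => hu.2 (h' hu.1.2), (extChartAt (𝓡 n) x).map_target hu.1.1⟩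

variable {M' : Type*} [EMetricSpace M'] [SecondCountableTopology M']
    [ChartedSpace (EuclideanSpace ℝ (Fin n)) M'] [IsManifold (𝓡 n) ∞ M']
    [RiemannianBundle (fun x : M' => TangentSpace (𝓡 n) x)]
    [IsContMDiffRiemannianBundle (𝓡 n) ∞ (EuclideanSpace ℝ (Fin n))
      (fun x : M' => TangentSpace (𝓡 n) x)]
    [MeasurableSpace M'] [BorelSpace M']

omit [SecondCountableTopology M] [RiemannianBundle (fun x : M => TangentSpace (𝓡 n) x)]
  [IsContMDiffRiemannianBundle (𝓡 n) ∞ (EuclideanSpace ℝ (Fin n))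
    (fun x : M => TangentSpace (𝓡 n) x)]
  [MeasurableSpace M] [BorelSpace M] [SecondCountableTopology M'] [RiemannianBundle (fun x : M' => TangentSpace (𝓡 n) x)]
  [IsContMDiffRiemannianBundle (𝓡 n) ∞ (EuclideanSpace ℝ (Fin n))
    (fun x : M' => TangentSpace (𝓡 n) x)]
  [MeasurableSpace M'] [BorelSpace M'] in
/-- The chain rule for the coordinate representation of a differentiable map. -/
theorem MDifferentiableAt.hasFDerivAt_extChartAt_comp {f : M → M'} (x : M) (y : M')
    {u : EuclideanSpace ℝ (Fin n)} (hu : u ∈ (extChartAt (𝓡 n) x).target)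
    (hfu : f ((extChartAt (𝓡 n) x).symm u) ∈ (extChartAt (𝓡 n) y).source)
    (hf : MDifferentiableAt (𝓡 n) (𝓡 n) f ((extChartAt (𝓡 n) x).symm u)) :
    ∃ (W : EuclideanSpace ℝ (Fin n) →L[ℝ] TangentSpace (𝓡 n) ((extChartAt (𝓡 n) x).symm u))
      (V : TangentSpace (𝓡 n) (f ((extChartAt (𝓡 n) x).symm u)) →L[ℝ] EuclideanSpace ℝ (Fin n)),
      HasFDerivAt (extChartAt (𝓡 n) y ∘ f ∘ (extChartAt (𝓡 n) x).symm)
        (V ∘L mfderiv (𝓡 n) (𝓡 n) f ((extChartAt (𝓡 n) x).symm u) ∘L W) u := by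
  have hfu' : f ((extChartAt (𝓡 n) x).symm u) ∈
      (chartAt (EuclideanSpace ℝ (Fin n)) y).source := by
    rwa [extChartAt_source] at hfu
  have : IsManifold (𝓡 n) 1 M' := IsManifold.of_le (n := ∞) (by simp)
  have h1 := (mdifferentiableAt_extChartAt_symm' x hu).hasMFDerivAt
  have h2 := (mdifferentiableAt_extChartAt (I := 𝓡 n) hfu').hasMFDerivAt
  exact ⟨_, _, hasMFDerivAt_iff_hasFDerivAt.1 (h2.comp u (hf.hasMFDerivAt.comp u h1))⟩

variable [IsRiemannianManifold (𝓡 n) M]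

/-- The dilatation inequality in charts, at a point where the Jacobian does not vanish. -/
theorem chartDensity_mul_maxStretch_rpow_le (hn : n ≠ 0) {p : ℝ} {f : M → M'} (x : M) (y : M')
    {u : EuclideanSpace ℝ (Fin n)} (hu : u ∈ (extChartAt (𝓡 n) x).target)
    (hfu : f ((extChartAt (𝓡 n) x).symm u) ∈ (extChartAt (𝓡 n) y).source)
    (hf : MDifferentiableAt (𝓡 n) (𝓡 n) f ((extChartAt (𝓡 n) x).symm u))
    (hdet : (fderiv ℝ (extChartAt (𝓡 n) y ∘ f ∘ (extChartAt (𝓡 n) x).symm) u).det ≠ 0)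
    {Q : ℝ≥0∞} (hQ : outerDilatation n p f ((extChartAt (𝓡 n) x).symm u) ≤ Q) :
    chartDensity x u * maxStretch f ((extChartAt (𝓡 n) x).symm u) ^ p ≤
      ENNReal.ofReal |(fderiv ℝ (extChartAt (𝓡 n) y ∘ f ∘ (extChartAt (𝓡 n) x).symm) u).det| *
        chartDensity y (extChartAt (𝓡 n) y (f ((extChartAt (𝓡 n) x).symm u))) * Q := by
  obtain ⟨W, V, hWV⟩ := hf.hasFDerivAt_extChartAt_comp x y hu hfu
  have hJ := volumeJacobian_mul_chartDensity_le f x y hu hfu hf.continuousAt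
    hWV.differentiableAt.hasFDerivAt hdet
  -- A zero differential would give zero determinant, which requires `n ≠ 0`: in dimension zero the
  -- determinant of the zero map is `1`.
  have hmf : mfderiv (𝓡 n) (𝓡 n) f ((extChartAt (𝓡 n) x).symm u) ≠ 0 := by
    intro h0
    apply hdet
    rw [hWV.fderiv, h0, ContinuousLinearMap.zero_comp, ContinuousLinearMap.comp_zero]
    change LinearMap.det (0 : EuclideanSpace ℝ (Fin n) →ₗ[ℝ] EuclideanSpace ℝ (Fin n)) = 0
    rw [LinearMap.det_zero, finrank_euclideanSpace_fin, zero_pow hn]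
  set z := (extChartAt (𝓡 n) x).symm u with hz
  set J := volumeJacobian (riemannianVolume (n := n) M) (riemannianVolume (n := n) M') f z with hJdef
  set R := ENNReal.ofReal
    |(fderiv ℝ (extChartAt (𝓡 n) y ∘ f ∘ (extChartAt (𝓡 n) x).symm) u).det| *
      chartDensity y (extChartAt (𝓡 n) y (f z)) with hR
  have hw := chartDensity_ne_zero x hu
  by_cases hJ0 : J = 0
  -- The dilatation equals `1` only where the differential vanishes; here it does not, so the
  -- dilatation and `Q` are infinite.
  · have hQtop : Q = ⊤ := by
      rw [outerDilatation, if_neg (by simpa using hJ0), if_neg (fun h => hmf h.2)] at hQ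
      exact top_le_iff.1 hQ
    have hR0 : R ≠ 0 := mul_ne_zero (by simpa using hdet)
      (chartDensity_ne_zero y ((extChartAt (𝓡 n) y).map_source hfu))
    rw [hQtop, ENNReal.mul_top hR0]
    exact le_top
  · have hRtop : R ≠ ⊤ := ENNReal.mul_ne_top ENNReal.ofReal_ne_top (chartDensity_ne_top _ _)
    have hJtop : J ≠ ⊤ := by
      intro h
      rw [h, ENNReal.top_mul hw, top_le_iff] at hJ
      exact hRtop hJ
    rw [outerDilatation, if_pos hJ0,
      ENNReal.div_le_iff_le_mul (Or.inl hJ0) (Or.inl hJtop)] at hQ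
    calc chartDensity x u * maxStretch f z ^ p ≤ chartDensity x u * (Q * J) := by gcongr
      _ = J * chartDensity x u * Q := by ring
      _ ≤ R * Q := by gcongr

omit [IsRiemannianManifold (𝓡 n) M] [IsContMDiffRiemannianBundle (𝓡 n) ∞ (EuclideanSpace ℝ (Fin n))
    (fun x : M' => TangentSpace (𝓡 n) x)] in
/-- For a map with Luzin's property `N⁻¹`, the Jacobian does not vanish almost everywhere. -/
theorem LuzinNInv.ae_det_fderiv_ne_zero {f : M → M'} {D : Set M}
    (hNinv : LuzinNInv (riemannianVolume (n := n) M) (riemannianVolume (n := n) M') f D)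
    (x : M) (y : M') {U : Set (EuclideanSpace ℝ (Fin n))} (hU : MeasurableSet U)
    (hUt : U ⊆ (extChartAt (𝓡 n) x).target)
    (hUD : ∀ u ∈ U, (extChartAt (𝓡 n) x).symm u ∈ D)
    (hfU : ∀ u ∈ U, f ((extChartAt (𝓡 n) x).symm u) ∈ (extChartAt (𝓡 n) y).source)
    (hdiff : ∀ᵐ u ∂volume.restrict U,
      DifferentiableAt ℝ (extChartAt (𝓡 n) y ∘ f ∘ (extChartAt (𝓡 n) x).symm) u) :
    ∀ᵐ u ∂volume.restrict U,
      (fderiv ℝ (extChartAt (𝓡 n) y ∘ f ∘ (extChartAt (𝓡 n) x).symm) u).det ≠ 0 := by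
  set φ := extChartAt (𝓡 n) x with hφ
  set ψ := extChartAt (𝓡 n) y with hψ
  set F := ψ ∘ f ∘ φ.symm with hFdef
  set Z := {u ∈ U | DifferentiableAt ℝ F u ∧ (fderiv ℝ F u).det = 0} with hZ
  -- The critical set has null image, as in Sard's lemma but with differentiability only. Charts
  -- preserve null sets, so `N⁻¹` carries this back to the critical set itself.
  have h1 : volume (F '' Z) = 0 :=
    addHaar_image_eq_zero_of_det_fderivWithin_eq_zero volume
      (fun u hu => hu.2.1.hasFDerivAt.hasFDerivWithinAt) fun u hu => hu.2.2
  have h2 : riemannianVolume (n := n) M' (ψ.symm '' (F '' Z)) = 0 := by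
    refine riemannianVolume_image_symm_eq_zero y ?_ h1
    rintro _ ⟨u, hu, rfl⟩
    exact ψ.map_source (hfU u hu.1)
  have h3 : f '' (φ.symm '' Z) ⊆ ψ.symm '' (F '' Z) := by
    rintro _ ⟨_, ⟨u, hu, rfl⟩, rfl⟩
    exact ⟨F u, ⟨u, hu, rfl⟩, ψ.left_inv (hfU u hu.1)⟩
  have h4 : riemannianVolume (n := n) M (φ.symm '' Z) = 0 := by
    refine hNinv _ ?_ (measure_mono_null h3 h2)
    rintro _ ⟨u, hu, rfl⟩
    exact hUD u hu.1
  have h5 : volume Z = 0 := by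
    refine measure_mono_null ?_ (volume_target_inter_preimage_eq_zero x ?_ h4)
    · exact fun u hu => ⟨hUt hu.1, u, hu, rfl⟩
    · rintro _ ⟨u, hu, rfl⟩
      exact φ.map_target (hUt hu.1)
  rw [ae_restrict_iff' hU] at hdiff ⊢
  filter_upwards [hdiff, measure_eq_zero_iff_ae_notMem.1 h5] with u hu1 hu2 huU h0
  exact hu2 ⟨huU, hu1 huU, h0⟩

/-- The integral estimate on a piece which `f` maps from one chart to another one. -/
theorem exists_multiplicity_setLIntegral_maxStretch_le (hn : n ≠ 0) {p : ℝ} {f : M → M'}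
    {D : Set M}
    (hdiff : ∀ᵐ x ∂(riemannianVolume (n := n) M).restrict D, MDifferentiableAt (𝓡 n) (𝓡 n) f x)
    (hNinv : LuzinNInv (riemannianVolume (n := n) M) (riemannianVolume (n := n) M') f D)
    {q : M' → ℝ≥0∞} (hq : Measurable q)
    (hK : ∀ᵐ x ∂(riemannianVolume (n := n) M).restrict D, outerDilatation n p f x ≤ q (f x))
    (x : M) (y : M') {P : Set M} (hP : MeasurableSet P) (hPD : P ⊆ D)
    (hPx : P ⊆ (extChartAt (𝓡 n) x).source) (hPy : MapsTo f P (extChartAt (𝓡 n) y).source)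
    {h : M' → ℝ≥0∞} (hh : Measurable h)
    (hm : AEMeasurable (fun z => h (f z) * maxStretch f z ^ p)
      ((riemannianVolume (n := n) M).restrict P)) :
    ∃ N : M' → ℝ≥0∞, Measurable N ∧ (∀ z, N z ≤ preimageCount f P z) ∧
      ∫⁻ z in P, h (f z) * maxStretch f z ^ p ∂(riemannianVolume (n := n) M) ≤
        ∫⁻ z, h z * q z * N z ∂(riemannianVolume (n := n) M') := by
  set φ := extChartAt (𝓡 n) x with hφ
  set ψ := extChartAt (𝓡 n) y with hψ
  set F := ψ ∘ f ∘ φ.symm with hFdef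
  set U := φ.target ∩ φ.symm ⁻¹' P with hU
  have hUm : MeasurableSet U := measurableSet_target_inter_preimage (n := n) x hP
  have hd : ∀ᵐ u ∂volume.restrict U, MDifferentiableAt (𝓡 n) (𝓡 n) f (φ.symm u) :=
    ae_target_inter_preimage x hP (ae_restrict_of_ae_restrict_of_subset hPD hdiff)
  have hk : ∀ᵐ u ∂volume.restrict U, outerDilatation n p f (φ.symm u) ≤ q (f (φ.symm u)) :=
    ae_target_inter_preimage x hP (ae_restrict_of_ae_restrict_of_subset hPD hK)
  have hF : ∀ᵐ u ∂volume.restrict U, DifferentiableAt ℝ F u := by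
    filter_upwards [hd, ae_restrict_mem hUm] with u hu huU
    obtain ⟨W, V, hWV⟩ := hu.hasFDerivAt_extChartAt_comp x y huU.1 (hPy huU.2)
    exact hWV.differentiableAt
  have hdet : ∀ᵐ u ∂volume.restrict U, (fderiv ℝ F u).det ≠ 0 :=
    hNinv.ae_det_fderiv_ne_zero x y hUm inter_subset_left (fun u hu => hPD hu.2)
      (fun u hu => hPy hu.2) hF
  have hgood : ∀ᵐ u ∂volume.restrict U, u ∈ U ∧ DifferentiableAt ℝ F u ∧ (fderiv ℝ F u).det ≠ 0 ∧
      chartDensity x u * maxStretch f (φ.symm u) ^ p ≤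
        ENNReal.ofReal |(fderiv ℝ F u).det| * chartDensity y (ψ (f (φ.symm u))) *
          q (f (φ.symm u)) := by
    filter_upwards [hd, hk, hF, hdet, ae_restrict_mem hUm] with u h1 h2 h3 h4 h5
    exact ⟨h5, h3, h4, chartDensity_mul_maxStretch_rpow_le hn x y h5.1 (hPy h5.2) h1 h4 h2⟩
  -- The exceptional set need not be measurable; removing a measurable null hull leaves a measurable
  -- `S` of full measure on which every condition holds pointwise.
  set T := toMeasurable (volume.restrict U) {u | ¬ (u ∈ U ∧ DifferentiableAt ℝ F u ∧
    (fderiv ℝ F u).det ≠ 0 ∧ chartDensity x u * maxStretch f (φ.symm u) ^ p ≤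
        ENNReal.ofReal |(fderiv ℝ F u).det| * chartDensity y (ψ (f (φ.symm u))) *
          q (f (φ.symm u)))} with hT
  have hT0 : volume.restrict U T = 0 := by
    rw [hT, measure_toMeasurable]
    exact hgood
  set S := U \ T with hSdef
  have hSm : MeasurableSet S := hUm.diff (measurableSet_toMeasurable _ _)
  have hSgood : ∀ u ∈ S, u ∈ U ∧ DifferentiableAt ℝ F u ∧ (fderiv ℝ F u).det ≠ 0 ∧
      chartDensity x u * maxStretch f (φ.symm u) ^ p ≤
        ENNReal.ofReal |(fderiv ℝ F u).det| * chartDensity y (ψ (f (φ.symm u))) *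
          q (f (φ.symm u)) := by
    intro u hu
    by_contra hbad
    exact hu.2 (subset_toMeasurable _ _ hbad)
  have hSU : S =ᵐ[volume] U := by
    refine (ae_eq_set).2 ⟨?_, ?_⟩
    · rw [hSdef, sdiff_eq_empty.2 sdiff_subset, measure_empty]
    · rw [Measure.restrict_apply (measurableSet_toMeasurable _ _), inter_comm] at hT0
      rwa [hSdef, sdiff_sdiff_right_self]
  obtain ⟨N, hNm, hNle, hN⟩ := exists_multiplicity_setLIntegral_eq f y φ.symm (P := P) hSm
    (φ.symm.injOn.mono fun u hu => hu.1.1) (fun u hu => hu.1.2) (fun u hu => hPy hu.1.2)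
    (fun u hu => (hSgood u hu).2.1.hasFDerivAt) (fun u hu => (hSgood u hu).2.2.1)
  refine ⟨N, hNm, hNle, ?_⟩
  rw [setLIntegral_riemannianVolume x hP hPx hm, ← hN (fun z => h z * q z) (hh.mul hq),
    ← setLIntegral_congr (μ := volume) hSU]
  refine setLIntegral_mono' hSm fun u hu => ?_
  calc chartDensity x u * (h (f (φ.symm u)) * maxStretch f (φ.symm u) ^ p)
      = h (f (φ.symm u)) * (chartDensity x u * maxStretch f (φ.symm u) ^ p) := by ring
    _ ≤ h (f (φ.symm u)) * (ENNReal.ofReal |(fderiv ℝ F u).det| *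
          chartDensity y (ψ (f (φ.symm u))) * q (f (φ.symm u))) :=
        mul_le_mul' le_rfl (hSgood u hu).2.2.2
    _ = _ := by ring

end Dilatation

/-! ### Assembly over pairs of charts. -/

theorem mainTheorem11 (n : ℕ) (hn : 2 ≤ n) (p : ℝ) (hp : 1 ≤ p)
    {M : Type*} [EMetricSpace M] [SecondCountableTopology M]
    [ChartedSpace (EuclideanSpace ℝ (Fin n)) M] [IsManifold (𝓡 n) ∞ M]
    [RiemannianBundle (fun x : M => TangentSpace (𝓡 n) x)]
    [IsContMDiffRiemannianBundle (𝓡 n) ∞ (EuclideanSpace ℝ (Fin n))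
      (fun x : M => TangentSpace (𝓡 n) x)]
    [IsRiemannianManifold (𝓡 n) M] [MeasurableSpace M] [BorelSpace M]
    {M' : Type*} [EMetricSpace M'] [SecondCountableTopology M']
    [ChartedSpace (EuclideanSpace ℝ (Fin n)) M'] [IsManifold (𝓡 n) ∞ M']
    [RiemannianBundle (fun x : M' => TangentSpace (𝓡 n) x)]
    [IsContMDiffRiemannianBundle (𝓡 n) ∞ (EuclideanSpace ℝ (Fin n))
      (fun x : M' => TangentSpace (𝓡 n) x)]
    [IsRiemannianManifold (𝓡 n) M'] [MeasurableSpace M'] [BorelSpace M']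
    (D : Set M) (hDo : IsOpen D) (hDc : IsConnected D)
    (f : M → M') (hf : ContinuousOn f D)
    (hdiff : ∀ᵐ x ∂(riemannianVolume (n := n) M).restrict D, MDifferentiableAt (𝓡 n) (𝓡 n) f x)
    (hN : LuzinN (riemannianVolume (n := n) M) (riemannianVolume (n := n) M') f D)
    (hNinv : LuzinNInv (riemannianVolume (n := n) M) (riemannianVolume (n := n) M') f D)
    (hACP : IntervalCurve.ACP (riemannianVolume (n := n) M) p f D)
    (q : M' → ℝ≥0∞) (hq : Measurable q)
    (hK : ∀ᵐ x ∂(riemannianVolume (n := n) M).restrict D, outerDilatation n p f x ≤ q (f x))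
    (A : Set M) (hA : MeasurableSet A) (hAD : A ⊆ D)
    (Γ : Set (IntervalCurve M)) (hΓ : ∀ γ ∈ Γ, γ.LiesIn A)
    (ρ' : M' → ℝ≥0∞) (hρ' : IntervalCurve.Admissible (IntervalCurve.imageFamily f Γ) ρ') :
    IntervalCurve.modulus (riemannianVolume (n := n) M) p Γ ≤
      ∫⁻ y, ρ' y ^ p * preimageCount f A y * q y ∂(riemannianVolume (n := n) M') := by
  obtain ⟨x₀, hx₀⟩ := hDc.nonempty
  have : Nonempty M := ⟨x₀⟩
  have : Nonempty M' := ⟨f x₀⟩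
  obtain ⟨c, B, hBm, hBd, hBu, hBc⟩ := exists_partition_subset_chart_source n M
  obtain ⟨c', B', hBm', hBd', hBu', hBc'⟩ := exists_partition_subset_chart_source n M'
  -- Each piece lies in one chart and is mapped into one chart. The preimage is intersected with `A`
  -- because `f` is controlled only on `D`.
  let P : ℕ × ℕ → Set M := fun ij => (A ∩ B ij.1) ∩ (A ∩ f ⁻¹' B' ij.2)
  have hPm : ∀ ij, MeasurableSet (P ij) := by
    intro ij
    refine (hA.inter (hBm _)).inter ?_
    -- `A ∩ f⁻¹(B')` is the set where the indicator of `B'`, pulled back to `A` and extended by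
    -- zero, equals `1`.
    have h1 := hf.mono hAD |>.measurable_indicator_comp hA
      (measurable_one.indicator (hBm' ij.2) : Measurable ((B' ij.2).indicator (1 : M' → ℝ≥0∞)))
    have h2 := h1 (measurableSet_singleton 1)
    convert h2 using 1
    ext z
    by_cases hz : z ∈ A <;> by_cases hz' : f z ∈ B' ij.2 <;> simp [hz, hz']
  have hPd : Pairwise (Function.onFun Disjoint P) := by
    rintro ⟨i, j⟩ ⟨i', j'⟩ hij
    rw [Function.onFun, disjoint_left]
    rintro z ⟨⟨-, h1⟩, -, h2⟩ ⟨⟨-, h3⟩, -, h4⟩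
    apply hij
    have hi : i = i' := by
      by_contra h
      exact disjoint_left.1 (hBd h) h1 h3
    have hj : j = j' := by
      by_contra h
      exact disjoint_left.1 (hBd' h) h2 h4
    rw [hi, hj]
  have hPU : ⋃ ij, P ij = A := by
    refine subset_antisymm (iUnion_subset fun ij z hz => hz.1.1) fun z hz => ?_
    obtain ⟨i, hi⟩ := mem_iUnion.1 (hBu.symm ▸ mem_univ z)
    obtain ⟨j, hj⟩ := mem_iUnion.1 (hBu'.symm ▸ mem_univ (f z))
    exact mem_iUnion.2 ⟨(i, j), ⟨hz, hi⟩, hz, hj⟩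
  have hPA : ∀ ij, P ij ⊆ A := fun ij z hz => hz.1.1
  have hhm : Measurable fun y => ρ' y ^ p := hρ'.1.pow_const p
  have hgm : ∀ ij, AEMeasurable (fun z => ρ' (f z) ^ p * maxStretch f z ^ p)
      ((riemannianVolume (n := n) M).restrict (P ij)) := by
    intro ij
    have h1 := ContinuousOn.measurable_indicator_comp hA (hf.mono hAD) hhm
    have h2 := (measurable_indicator_maxStretch hDo hf).pow_const p
    refine (h1.mul h2).aemeasurable.congr ?_
    filter_upwards [ae_restrict_mem (hPm ij)] with z hz
    simp [hPA ij hz, hAD (hPA ij hz)]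
  choose N hNm hNle hNint using fun ij : ℕ × ℕ =>
    exists_multiplicity_setLIntegral_maxStretch_le (by omega) hdiff hNinv hq hK
      (c ij.1) (c' ij.2) (hPm ij) ((hPA ij).trans hAD) (fun z hz => hBc _ hz.1.2)
      (fun z hz => hBc' _ hz.2.2) hhm (hgm ij)
  calc IntervalCurve.modulus (riemannianVolume (n := n) M) p Γ
      ≤ ∫⁻ z in A, ρ' (f z) ^ p * maxStretch f z ^ p ∂(riemannianVolume (n := n) M) :=
        IntervalCurve.modulus_le_setLIntegral_maxStretch hp hDo hf hACP hA hAD hΓ hρ'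
    _ = ∑' ij, ∫⁻ z in P ij, ρ' (f z) ^ p * maxStretch f z ^ p
          ∂(riemannianVolume (n := n) M) := by
        conv_lhs => rw [← hPU]
        exact lintegral_iUnion hPm hPd _
    _ ≤ ∑' ij, ∫⁻ y, ρ' y ^ p * q y * N ij y ∂(riemannianVolume (n := n) M') :=
        ENNReal.tsum_le_tsum hNint
    _ = ∫⁻ y, ρ' y ^ p * q y * ∑' ij, N ij y ∂(riemannianVolume (n := n) M') := by
        simp only [← ENNReal.tsum_mul_left]
        rw [lintegral_tsum]
        exact fun ij => ((hhm.mul hq).mul (hNm ij)).aemeasurable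
    _ ≤ ∫⁻ y, ρ' y ^ p * preimageCount f A y * q y ∂(riemannianVolume (n := n) M') := by
        refine lintegral_mono fun y => ?_
        rw [mul_right_comm]
        gcongr
        exact (ENNReal.tsum_le_tsum fun ij => hNle ij y).trans (tsum_preimageCount_le f hPd hPA y)
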